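/- Let $\Delta\ge 3$ and $g\ge 3$ be integers. For $b\in[1,\rho_\Delta)$, where $\rho_\Delta=\left(\frac{\Delta-1}{\Delta-2}\right)^{\Delta}$, and for $a\in[0,1]$ and $d\in\mathbb N$, put $$x_\Delta(b)=\frac{b^{2/\Delta}-b^{1/\Delta}}{b},\qquad f_\Delta^d(b)=\frac{1}{\Delta-1}\,\frac{[(\Delta-1)(1-b^{-1/\Delta})]^d}{1-(\Delta-1)(1-b^{-1/\Delta})},$$ $$K_\Delta^g(a,b)=\big[1+(1-a)x_\Delta(b)\big]^\Delta-1+f_\Delta^{g-2}(b)\binom{\Delta}{2}\,b\,x_\Delta(b)\,\big(1+b\,x_\Delta(b)\big)^{\Delta-1},$$ $$b_\Delta^g(a)=\sup\{b\in[1,\rho_\Delta):K_\Delta^g(a,b)\le a\},\qquad z_\Delta^g(a)=(1-a)\,x_\Delta\big(b_\Delta^g(a)\big).$$ Then, for every $a\in[0,1]$, $b_\Delta^g(a)$ is the unique solution $b\in[1,\rho_\Delta)$ of the equation $K_\Delta^g(a,b)=a$; the function $z_\Delta^g$ attains a positive maximum on $[0,1]$; and, with $$C(\Delta,g)=\Big[\max_{a\in[0,1]}z_\Delta^g(a)\Big]^{-1},$$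 for every finite simple graph $G$ with maximum degree $\Delta$ and (finite) girth $g$, the chromatic polynomial $P_G$ (the polynomial whose value at each $n\in\mathbb N$ is the number of proper colourings of $G$ with $n$ colours) satisfies $P_G(q)\neq 0$ for all $q\in\mathbb C$ with $|q|\ge C(\Delta,g)$. -/

import Mathlib

open Set Polynomial

noncomputable section

namespace ChromaticZeros

/-- The number of proper colourings of a finite simple graph with `n` colours is a polynomial
in `n`. -/
theorem exists_chromaticPolynomial {V : Type*} [Fintype V] (G : SimpleGraph V) :
    ∃ P : ℤ[X], ∀ n : ℕ, P.eval (n : ℤ) = (Nat.card (G.Coloring (Fin n)) : ℤ) := by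
  classical
  haveI : Finite (Setoid V) :=
    Finite.of_injective (fun s : Setoid V => s.r) (fun s t h => Setoid.ext fun a b => by
      exact iff_of_eq (congrFun (congrFun h a) b))
  letI : Fintype {s : Setoid V // ∀ u v, G.Adj u v → ¬ s u v} := Fintype.ofFinite _
  refine ⟨∑ s : {s : Setoid V // ∀ u v, G.Adj u v → ¬ s u v},
    descPochhammer ℤ (Nat.card (Quotient s.1)), fun n => ?_⟩
  let φ : (Σ s : {s : Setoid V // ∀ u v, G.Adj u v → ¬ s u v}, (Quotient s.1 ↪ Fin n)) →
      G.Coloring (Fin n) := fun p =>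
    SimpleGraph.Coloring.mk (fun v => p.2 (Quotient.mk p.1.1 v)) (by
      intro u v h e
      exact p.1.2 u v h (Quotient.exact (p.2.injective e)))
  have hφ : Function.Bijective φ := by
    constructor
    · rintro ⟨⟨s, hs⟩, f⟩ ⟨⟨t, ht⟩, f'⟩ h
      have h1 : ∀ v, f (Quotient.mk s v) = f' (Quotient.mk t v) := fun v =>
        DFunLike.congr_fun h v
      have hst : s = t := by
        ext u v
        constructor
        · intro huv
          refine Quotient.exact (f'.injective ?_)
          rw [← h1, ← h1]
          exact congrArg f (Quotient.sound huv)
        · intro huv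
          refine Quotient.exact (f.injective ?_)
          rw [h1, h1]
          exact congrArg f' (Quotient.sound huv)
      subst hst
      have hf : f = f' := by
        ext x
        induction x using Quotient.inductionOn with
        | h v => rw [h1 v]
      rw [hf]
    · intro c
      refine ⟨⟨⟨Setoid.ker c, fun _ _ h e => c.valid h e⟩,
        ⟨Quotient.lift c (fun _ _ h => h), ?_⟩⟩, ?_⟩
      · rintro ⟨u⟩ ⟨v⟩ h
        exact Quotient.sound h
      · ext v
        rfl
  rw [← Nat.card_congr (Equiv.ofBijective φ hφ), Nat.card_sigma, eval_finsetSum, Nat.cast_sum]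
  refine Finset.sum_congr rfl fun s _ => ?_
  rw [descPochhammer_eval_eq_descFactorial, Nat.card_eq_fintype_card, Nat.card_eq_fintype_card,
    Fintype.card_embedding_eq, Fintype.card_fin]

/-- The chromatic polynomial `P_G` of a finite simple graph: the (necessarily unique) polynomial
whose value at every natural number `n` is the number of proper colourings of `G` with `n`
colours. -/
def chromaticPolynomial {V : Type*} [Fintype V] (G : SimpleGraph V) : ℤ[X] :=
  Classical.choose (exists_chromaticPolynomial G)

/-- The defining property of the chromatic polynomial. -/
theorem eval_chromaticPolynomial {V : Type*} [Fintype V] (G : SimpleGraph V) (n : ℕ) :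
    (chromaticPolynomial G).eval (n : ℤ) = (Nat.card (G.Coloring (Fin n)) : ℤ) :=
  Classical.choose_spec (exists_chromaticPolynomial G) n

/-- `ρ_Δ = ((Δ - 1) / (Δ - 2)) ^ Δ`. -/
def rho (Δ : ℕ) : ℝ := (((Δ : ℝ) - 1) / ((Δ : ℝ) - 2)) ^ Δ

/-- `x_Δ(b) = (b ^ (2/Δ) - b ^ (1/Δ)) / b`. -/
def x (Δ : ℕ) (b : ℝ) : ℝ := (b ^ (2 / (Δ : ℝ)) - b ^ (1 / (Δ : ℝ))) / b

/-- `f_Δ^d(b) = 1/(Δ-1) * [(Δ-1)(1 - b^(-1/Δ))]^d / [1 - (Δ-1)(1 - b^(-1/Δ))]`. -/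
def f (Δ d : ℕ) (b : ℝ) : ℝ :=
  1 / ((Δ : ℝ) - 1) *
    ((((Δ : ℝ) - 1) * (1 - b ^ (-(1 / (Δ : ℝ))))) ^ d /
      (1 - ((Δ : ℝ) - 1) * (1 - b ^ (-(1 / (Δ : ℝ))))))

/-- `K_Δ^g(a, b) = [1 + (1-a) x_Δ(b)]^Δ - 1
  + f_Δ^(g-2)(b) * (Δ choose 2) * b x_Δ(b) * (1 + b x_Δ(b))^(Δ-1)`. -/
def K (Δ g : ℕ) (a b : ℝ) : ℝ :=
  (1 + (1 - a) * x Δ b) ^ Δ - 1 +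
    f Δ (g - 2) b * (Δ.choose 2 : ℝ) * (b * x Δ b) * (1 + b * x Δ b) ^ (Δ - 1)

/-- `b_Δ^g(a) = sup {b ∈ [1, ρ_Δ) : K_Δ^g(a, b) ≤ a}`. -/
def bsup (Δ g : ℕ) (a : ℝ) : ℝ := sSup {b : ℝ | b ∈ Ico 1 (rho Δ) ∧ K Δ g a b ≤ a}

/-- `z_Δ^g(a) = (1 - a) x_Δ(b_Δ^g(a))`. -/
def z (Δ g : ℕ) (a : ℝ) : ℝ := (1 - a) * x Δ (bsup Δ g a)

/-- `C(Δ, g) = [max_{a ∈ [0,1]} z_Δ^g(a)]⁻¹` (that the supremum is a maximum is part of the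
theorem). -/
def C (Δ g : ℕ) : ℝ := (sSup (z Δ g '' Icc 0 1))⁻¹

end ChromaticZeros

end

/-! Inclusion–exclusion writes `P_G(q)` as a sum over partitions of the vertex set, a block `B`
having weight `q κ(B)`; here `κ` is the logarithm, for disjoint-union convolution, of the indicator
of independent sets. Up to sign, `κ(B)` is a nonnegative number `c(B)`, and `c` satisfies a
recursion (`conn_insert`): `c(B ∪ {v})` sums the products of `c` over the partitions of `B` all of
whose blocks meet the neighbourhood of `v`.

Put `x = -1/q` and `F(S) = q^(-|S|) P_{G[S]}(q)`. Induction on `S` shows that adding a vertex `u`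
changes `F` little: `|F(S ∪ {u}) - F(S)| ≤ a |F(S)|` with `a < 1`, so `F` never vanishes. If the `m`
neighbours of `u` in `S` lay in different components, `F` would be multiplied by exactly `(1 +
x)^m`. The error comes from blocks that contain two neighbours of `u` (`norm_coneExp_sub_le`). By
induction, a factor `|x| ≤ (1 - a) s` for each removed vertex lets `F(S \ T)` be compared with
`F(S)`, and what remains is a sum of positive terms in `c` and `s`.

Those sums are controlled by the recursion for `c`. Blocks through one vertex contribute at most `Y`
as soon as `(1 + s Y)^(Δ-1) ≤ Y` (`pairSum_self_le`). Blocks through two vertices are bounded by a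
geometric series over the paths joining them (`pairSum_le_of_far`), and the girth makes these paths
long when the two vertices are neighbours of a vertex outside the set (`far_of_le_egirth`).

With `b = t^Δ`, the choice `s = x_Δ(b)`, `Y = t^(Δ-1)` gives `1 + s Y = t`, and the induction closes
when `K_Δ^g(a, b) ≤ a`. Monotonicity of `K` in `b` gives the unique solution, compactness gives the
maximum, and the best `a` gives the radius. -/

namespace SubsetExp

/-! ### Exponential and logarithm of set functions. -/

section Algebra

variable {V : Type*} [DecidableEq V] {R : Type*} [CommRing R]

/-- The sum of `∏ φ B` over the partitions of `S` into blocks `B`, defined by singling out the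
block of one element. -/
noncomputable def setExp (φ : Finset V → R) (S : Finset V) : R :=
  open Classical in
  if h : S.Nonempty then
    ∑ T ∈ (S.erase h.choose).powerset,
      φ (insert h.choose T) * setExp φ ((S.erase h.choose) \ T)
  else 1
termination_by S.card
decreasing_by
  exact (Finset.card_le_card Finset.sdiff_subset).trans_lt
    (Finset.card_erase_lt_of_mem h.choose_spec)

@[simp] theorem setExp_empty (φ : Finset V → R) : setExp φ ∅ = 1 := by
  rw [setExp]; simp

theorem sum_powerset_sdiff_comm {M : Type*} [AddCommMonoid M] (S : Finset V)
    (h : Finset V → Finset V → M) :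
    ∑ T ∈ S.powerset, ∑ U ∈ (S \ T).powerset, h T U =
      ∑ U ∈ S.powerset, ∑ T ∈ (S \ U).powerset, h T U := by
  refine Finset.sum_comm' fun T U => ?_
  simp only [Finset.mem_powerset, Finset.subset_sdiff, disjoint_comm (a := T)]
  tauto

theorem sum_powerset_assoc {M : Type*} [AddCommMonoid M] (S : Finset V)
    (h : Finset V → Finset V → Finset V → M) :
    ∑ U ∈ S.powerset, ∑ T ∈ U.powerset, h T (U \ T) (S \ U) =
      ∑ T ∈ S.powerset, ∑ U ∈ (S \ T).powerset, h T U ((S \ T) \ U) := by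
  have : ∑ U ∈ S.powerset, ∑ T ∈ U.powerset, h T (U \ T) (S \ U) =
      ∑ T ∈ S.powerset, ∑ U ∈ S.powerset with T ⊆ U, h T (U \ T) (S \ U) := by
    refine Finset.sum_comm' fun U T => ?_
    simp only [Finset.mem_powerset, Finset.mem_filter]
    exact ⟨fun h => ⟨⟨h.1, h.2⟩, h.2.trans h.1⟩, fun h => h.1⟩
  rw [this]
  refine Finset.sum_congr rfl fun T hT => ?_
  rw [Finset.mem_powerset] at hT
  refine Finset.sum_nbij' (fun U => U \ T) (fun U => T ∪ U) ?_ ?_ ?_ ?_ ?_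
  · intro U hU
    simp only [Finset.mem_powerset, Finset.mem_filter] at hU ⊢
    exact Finset.sdiff_subset_sdiff hU.1 le_rfl
  · intro U hU
    simp only [Finset.mem_powerset, Finset.mem_filter] at hU ⊢
    exact ⟨Finset.union_subset hT (hU.trans Finset.sdiff_subset), Finset.subset_union_left⟩
  · intro U hU
    simp only [Finset.mem_powerset, Finset.mem_filter] at hU
    exact Finset.union_sdiff_of_subset hU.2
  · intro U hU
    simp only [Finset.mem_powerset, Finset.subset_sdiff] at hU
    exact Finset.union_sdiff_cancel_left hU.2.symm
  · intro U hU
    simp only [Finset.mem_powerset, Finset.mem_filter] at hU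
    rw [sdiff_sdiff_left, Finset.sup_eq_union, Finset.union_sdiff_of_subset hU.2]

theorem insert_sdiff_of_subset {S T : Finset V} {v : V} (hv : v ∉ S) (hT : T ⊆ S) :
    insert v S \ T = insert v (S \ T) :=
  Finset.insert_sdiff_of_notMem _ fun h => hv (hT h)

theorem sum_powerset_insert_sdiff {M : Type*} [AddCommMonoid M] {S : Finset V} {v : V}
    (hv : v ∉ S) (h : Finset V → Finset V → M) :
    ∑ T ∈ (insert v S).powerset, h T (insert v S \ T) =
      ∑ T ∈ S.powerset, h T (insert v (S \ T)) + ∑ T ∈ S.powerset, h (insert v T) (S \ T) := by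
  rw [Finset.sum_powerset_insert hv]
  congr 1
  · refine Finset.sum_congr rfl fun T hT => ?_
    rw [insert_sdiff_of_subset hv (Finset.mem_powerset.1 hT)]
  · refine Finset.sum_congr rfl fun T hT => ?_
    rw [Finset.insert_sdiff_insert, Finset.sdiff_insert_of_notMem hv]

/-- The sum does not depend on which element is singled out. If the chosen element is `r ≠ v`,
either `r` and `v` share a block, or their two blocks can be split off in either order; the
induction hypothesis performs the second split. -/
theorem setExp_insert (φ : Finset V → R) {S : Finset V} {v : V} (hv : v ∉ S) :
    setExp φ (insert v S) = ∑ T ∈ S.powerset, φ (insert v T) * setExp φ (S \ T) := by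
  induction hn : S.card using Nat.strong_induction_on generalizing S v with
  | _ n ih =>
  subst hn
  have hne : (insert v S).Nonempty := Finset.insert_nonempty v S
  rw [setExp, dif_pos hne]
  have hr := hne.choose_spec
  generalize hne.choose = r at hr
  rcases Finset.mem_insert.1 hr with rfl | hrS
  · rw [Finset.erase_insert hv]
  · obtain ⟨S, hrS', rfl⟩ : ∃ S', r ∉ S' ∧ S = insert r S' :=
      ⟨S.erase r, Finset.notMem_erase _ _, (Finset.insert_erase hrS).symm⟩
    rw [Finset.mem_insert, not_or] at hv
    have hrv : r ∉ insert v S := by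
      rw [Finset.mem_insert, not_or]; exact ⟨fun h => hv.1 h.symm, hrS'⟩
    rw [Finset.insert_comm, Finset.erase_insert hrv,
      sum_powerset_insert_sdiff hv.2 (fun A B => φ (insert r A) * setExp φ B),
      sum_powerset_insert_sdiff hrS' (fun A B => φ (insert v A) * setExp φ B)]
    have key : ∀ w ∉ S, ∀ T ∈ S.powerset, setExp φ (insert w (S \ T)) =
        ∑ U ∈ (S \ T).powerset, φ (insert w U) * setExp φ ((S \ T) \ U) := by
      intro w hw T _
      refine ih (S \ T).card ?_ (fun h => hw (Finset.mem_sdiff.1 h).1) rfl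
      rw [Finset.card_insert_of_notMem hrS']
      exact Nat.lt_succ_of_le (Finset.card_le_card Finset.sdiff_subset)
    congr 1
    · calc _ = ∑ T ∈ S.powerset, ∑ U ∈ (S \ T).powerset,
            φ (insert r T) * (φ (insert v U) * setExp φ ((S \ T) \ U)) :=
            Finset.sum_congr rfl fun T hT => by rw [key v hv.2 T hT, Finset.mul_sum]
        _ = _ := by
            rw [sum_powerset_sdiff_comm]
            refine Finset.sum_congr rfl fun T hT => ?_
            rw [key r hrS' T hT, Finset.mul_sum]
            refine Finset.sum_congr rfl fun U _ => ?_
            rw [sdiff_right_comm]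
            ring
    · refine Finset.sum_congr rfl fun T _ => ?_
      rw [Finset.insert_comm]

theorem finset_insert_induction {p : Finset V → Prop} (empty : p ∅)
    (insert : ∀ (v : V) (S : Finset V), v ∉ S → (∀ T ⊆ S, p T) → p (insert v S))
    (S : Finset V) : p S := by
  induction S using Finset.strongInduction with
  | H S ih =>
  rcases S.eq_empty_or_nonempty with rfl | ⟨v, hv⟩
  · exact empty
  · rw [← Finset.insert_erase hv]
    refine insert v _ (Finset.notMem_erase _ _) fun T hT => ih T ?_
    exact hT.trans_ssubset (Finset.erase_ssubset hv)

theorem setExp_congr {φ ψ : Finset V → R} {S : Finset V} (h : ∀ T ⊆ S, T.Nonempty → φ T = ψ T) :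
    setExp φ S = setExp ψ S := by
  induction S using finset_insert_induction with
  | empty => simp
  | insert v S hv ih =>
  rw [setExp_insert φ hv, setExp_insert ψ hv]
  refine Finset.sum_congr rfl fun T hT => ?_
  rw [Finset.mem_powerset] at hT
  rw [h _ (Finset.insert_subset_insert v hT) (Finset.insert_nonempty _ _),
    ih _ Finset.sdiff_subset fun U hU => h U
      (hU.trans (Finset.sdiff_subset.trans (Finset.subset_insert _ _)))]

/-- Expanding the product labels each block `φ` or `ψ`; `T` is the union of the blocks labelled `φ`.
-/
theorem setExp_add (φ ψ : Finset V → R) (S : Finset V) :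
    setExp (fun B => φ B + ψ B) S = ∑ T ∈ S.powerset, setExp φ T * setExp ψ (S \ T) := by
  induction S using finset_insert_induction with
  | empty => simp
  | insert v S hv ih =>
  rw [setExp_insert _ hv, sum_powerset_insert_sdiff hv fun A B => setExp φ A * setExp ψ B]
  simp only [add_mul]
  rw [Finset.sum_add_distrib, add_comm]
  congr 1
  · calc _ = ∑ T ∈ S.powerset, ∑ U ∈ (S \ T).powerset,
          ψ (insert v T) * (setExp φ U * setExp ψ ((S \ T) \ U)) := by
          refine Finset.sum_congr rfl fun T _ => ?_
          rw [ih _ Finset.sdiff_subset, Finset.mul_sum]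
      _ = _ := by
          rw [sum_powerset_sdiff_comm]
          refine Finset.sum_congr rfl fun T _ => ?_
          rw [setExp_insert ψ (fun h => hv (Finset.mem_sdiff.1 h).1), Finset.mul_sum]
          refine Finset.sum_congr rfl fun U _ => ?_
          rw [sdiff_right_comm]; ring
  · calc _ = ∑ T ∈ S.powerset, ∑ U ∈ (S \ T).powerset,
          φ (insert v T) * (setExp φ U * setExp ψ ((S \ T) \ U)) := by
          refine Finset.sum_congr rfl fun T _ => ?_
          rw [ih _ Finset.sdiff_subset, Finset.mul_sum]
      _ = _ := by
          rw [← sum_powerset_assoc S fun A B C => φ (insert v A) * (setExp φ B * setExp ψ C)]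
          refine Finset.sum_congr rfl fun T hT => ?_
          rw [setExp_insert φ (fun h => hv (Finset.mem_powerset.1 hT h)), Finset.sum_mul]
          refine Finset.sum_congr rfl fun U _ => ?_
          ring

theorem setExp_pow_card_mul (φ : Finset V → R) (r : R) (S : Finset V) :
    setExp (fun B => r ^ B.card * φ B) S = r ^ S.card * setExp φ S := by
  induction S using finset_insert_induction with
  | empty => simp
  | insert v S hv ih =>
  rw [setExp_insert _ hv, setExp_insert _ hv, Finset.mul_sum]
  refine Finset.sum_congr rfl fun T hT => ?_
  rw [Finset.mem_powerset] at hT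
  rw [ih _ Finset.sdiff_subset, Finset.card_insert_of_notMem hv,
    Finset.card_insert_of_notMem fun h => hv (hT h), Finset.card_sdiff_of_subset hT]
  have := Finset.card_le_card hT
  obtain ⟨k, hk⟩ := Nat.exists_eq_add_of_le this
  rw [hk, Nat.add_sub_cancel_left]
  ring

theorem map_setExp {R' : Type*} [CommRing R'] (f : R →+* R') (φ : Finset V → R) (S : Finset V) :
    f (setExp φ S) = setExp (fun B => f (φ B)) S := by
  induction S using finset_insert_induction with
  | empty => simp
  | insert v S hv ih =>
  rw [setExp_insert _ hv, setExp_insert _ hv, map_sum]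
  refine Finset.sum_congr rfl fun T _ => ?_
  rw [map_mul, ih _ Finset.sdiff_subset]

theorem setExp_zero (S : Finset V) (hS : S.Nonempty) : setExp (fun _ => (0 : R)) S = 0 := by
  obtain ⟨v, hv⟩ := hS
  rw [← Finset.insert_erase hv, setExp_insert _ (Finset.notMem_erase _ _)]
  simp

/-- The weight `φ` restricted to the blocks that meet `W`. -/
def touching (W : Finset V) (φ : Finset V → R) (B : Finset V) : R :=
  if (B ∩ W).Nonempty then φ B else 0

/-- The weight `φ` restricted to the blocks that avoid `W`. -/
def avoiding (W : Finset V) (φ : Finset V → R) (B : Finset V) : R :=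
  if (B ∩ W).Nonempty then 0 else φ B

theorem setExp_avoiding (W : Finset V) (φ : Finset V → R) (S : Finset V) :
    setExp (avoiding W φ) S = if (S ∩ W).Nonempty then 0 else setExp φ S := by
  split_ifs with h
  · obtain ⟨w, hw⟩ := h
    rw [Finset.mem_inter] at hw
    rw [← Finset.insert_erase hw.1, setExp_insert _ (Finset.notMem_erase _ _)]
    refine Finset.sum_eq_zero fun T _ => ?_
    rw [avoiding, if_pos ⟨w, by simp [hw.2]⟩, zero_mul]
  · refine setExp_congr fun T hT _ => ?_
    rw [avoiding, if_neg fun h' => h (h'.mono (Finset.inter_subset_inter_right hT))]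

/-- Convolution with `I` is triangular for inclusion, with diagonal `I ∅ = 1`, so it can be
cancelled. -/
theorem eq_of_convolution_eq {A A' I : Finset V → R} (hI : I ∅ = 1) {S : Finset V}
    (h : ∀ T ⊆ S, ∑ U ∈ T.powerset, A U * I (T \ U) = ∑ U ∈ T.powerset, A' U * I (T \ U)) :
    A S = A' S := by
  induction S using Finset.strongInduction with
  | H S ih =>
  have := h S le_rfl
  rw [← Finset.sum_erase_add _ _ (Finset.mem_powerset_self S),
    ← Finset.sum_erase_add (a := S) S.powerset (fun U => A' U * I (S \ U))
      (Finset.mem_powerset_self S), Finset.sdiff_self, hI, mul_one, mul_one,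
    Finset.sum_congr rfl fun U hU => ?_] at this
  · exact add_left_cancel this
  · rw [Finset.mem_erase, Finset.mem_powerset] at hU
    rw [ih U (hU.2.ssubset_of_ne hU.1) fun T hT => h T (hT.trans hU.2)]

/-- The inverse of `setExp`. -/
noncomputable def setLog (I : Finset V → R) (S : Finset V) : R :=
  open Classical in
  if h : S.Nonempty then
    I S - ∑ T ∈ ((S.erase h.choose).powerset.erase (S.erase h.choose)).attach,
      setLog I (insert h.choose T.1) * I ((S.erase h.choose) \ T.1)
  else 0
termination_by S.card
decreasing_by
  have hT := Finset.mem_erase.1 T.2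
  rw [Finset.mem_powerset] at hT
  refine (Finset.card_insert_le _ _).trans_lt ?_
  have := Finset.card_lt_card (hT.2.ssubset_of_ne hT.1)
  have := Finset.card_erase_lt_of_mem h.choose_spec
  omega

theorem setExp_setLog (I : Finset V → R) (hI : I ∅ = 1) (S : Finset V) :
    setExp (setLog I) S = I S := by
  induction S using Finset.strongInduction with
  | H S ih =>
  rcases S.eq_empty_or_nonempty with rfl | h
  · simp [hI]
  rw [setExp, dif_pos h, ← Finset.sum_erase_add _ _ (Finset.mem_powerset_self _),
    Finset.sdiff_self, setExp_empty, mul_one, Finset.insert_erase h.choose_spec]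
  conv_lhs => rw [setLog, dif_pos h]
  rw [Finset.sum_attach ((S.erase h.choose).powerset.erase (S.erase h.choose)) fun T =>
    setLog I (insert h.choose T) * I ((S.erase h.choose) \ T)]
  rw [add_sub_left_comm, add_eq_left, sub_eq_zero]
  refine Finset.sum_congr rfl fun T _ => ?_
  rw [ih]
  exact Finset.sdiff_subset.trans_ssubset (Finset.erase_ssubset h.choose_spec)

theorem setExp_nonneg {R : Type*} [CommRing R] [PartialOrder R] [IsOrderedRing R]
    {φ : Finset V → R} {S : Finset V}
    (h : ∀ B ⊆ S, B.Nonempty → 0 ≤ φ B) : 0 ≤ setExp φ S := by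
  induction S using finset_insert_induction with
  | empty => simp
  | insert v S hv ih =>
  rw [setExp_insert _ hv]
  refine Finset.sum_nonneg fun T hT => mul_nonneg
    (h _ (Finset.insert_subset_insert v (Finset.mem_powerset.1 hT)) (Finset.insert_nonempty _ _)) ?_
  exact ih _ Finset.sdiff_subset fun B hB => h B
    (hB.trans (Finset.sdiff_subset.trans (Finset.subset_insert _ _)))

end Algebra

/-! ### The chromatic polynomial as a partition sum, and the recursion for its weights. -/

section Chromatic

variable {V : Type*} [DecidableEq V] [Fintype V] (G : SimpleGraph V) [DecidableRel G.Adj]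

/-- The indicator of the independent sets of vertices. -/
def indep (S : Finset V) : ℤ := if ∀ u ∈ S, ∀ v ∈ S, ¬ G.Adj u v then 1 else 0

theorem indep_empty : indep G ∅ = 1 := by simp [indep]

theorem indep_insert (v : V) (S : Finset V) :
    indep G (insert v S) = if (S ∩ G.neighborFinset v).Nonempty then 0 else indep G S := by
  by_cases h : (S ∩ G.neighborFinset v).Nonempty
  · obtain ⟨w, hw⟩ := h
    rw [if_pos ⟨w, hw⟩, indep, if_neg]
    rw [Finset.mem_inter, SimpleGraph.mem_neighborFinset] at hw
    intro h
    exact h v (by simp) w (by simp [hw.1]) hw.2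
  · rw [if_neg h]
    have h' : ∀ w ∈ S, ¬ G.Adj v w := fun w hw hvw => h ⟨w, by simp [hw, hvw]⟩
    have h'' : ∀ w ∈ S, ¬ G.Adj w v := fun w hw hvw => h' w hw hvw.symm
    simp only [indep, Finset.forall_mem_insert, SimpleGraph.irrefl, not_false_eq_true, true_and]
    congr 1
    refine propext ⟨fun h u hu w hw => (h.2 u hu).2 w hw,
      fun h => ⟨h', fun u hu => ⟨h'' u hu, h u hu⟩⟩⟩

/-- The coefficients of the exponential formula for the chromatic polynomial. -/
noncomputable def connWeight : Finset V → ℤ := setLog (indep G)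

theorem setExp_connWeight (S : Finset V) : setExp (connWeight G) S = indep G S :=
  setExp_setLog _ (indep_empty G) S

/-- Convolving the left side with `indep` gives `indep (insert v T)`, that is, `indep T` if `T`
avoids the neighbours of `v` and `0` otherwise. This is the partition sum restricted to blocks
avoiding the neighbours; since avoiding is everything minus touching, `setExp_add` factors out the
same `indep`, which then cancels. -/
theorem connWeight_insert {v : V} {S : Finset V} (hv : v ∉ S) :
    connWeight G (insert v S) =
      setExp (touching (G.neighborFinset v) fun B => -connWeight G B) S := by
  refine eq_of_convolution_eq (A := fun S => connWeight G (insert v S)) (indep_empty G)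
    fun T hT => ?_
  have h1 := setExp_insert (connWeight G) fun h => hv (hT h)
  simp only [setExp_connWeight, indep_insert] at h1
  rw [← h1]
  have h2 := setExp_add (touching (G.neighborFinset v) fun B => -connWeight G B)
    (connWeight G) T
  simp only [setExp_connWeight] at h2
  rw [← h2, ← setExp_connWeight, ← setExp_avoiding]
  refine setExp_congr fun U _ _ => ?_
  rw [touching, avoiding]
  split_ifs <;> simp

/-- The unsigned version of `connWeight`. -/
noncomputable def conn (B : Finset V) : ℤ := -((-1) ^ B.card * connWeight G B)

/-- The sign `(-1)^|B|` is multiplicative over blocks and the extra minus absorbs the one in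
`connWeight_insert`. The resulting recursion has only plus signs, whence positivity; every later
estimate on the weights rests on it. -/
theorem conn_insert {v : V} {S : Finset V} (hv : v ∉ S) :
    conn G (insert v S) = setExp (touching (G.neighborFinset v) (conn G)) S := by
  rw [conn, connWeight_insert G hv, Finset.card_insert_of_notMem hv, pow_succ]
  simp only [mul_neg, mul_one, neg_mul, neg_neg]
  rw [← setExp_pow_card_mul]
  refine setExp_congr fun B _ _ => ?_
  rw [touching, touching]
  split_ifs <;> simp [conn]

theorem conn_nonneg (S : Finset V) (hS : S.Nonempty) : 0 ≤ conn G S := by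
  induction S using finset_insert_induction with
  | empty => simp at hS
  | insert v S hv ih =>
  rw [conn_insert G hv]
  refine setExp_nonneg fun B hB hB' => ?_
  rw [touching]
  split_ifs
  exacts [ih B hB hB', le_rfl]

/-- Proper colourings of the vertices in `S` with the colours `0, …, n - 1`, extended by `0`. -/
def partialColorings (n : ℕ) (S : Finset V) : Finset (V → ℕ) :=
  (Fintype.piFinset fun v => if v ∈ S then Finset.range n else {0}).filter
    fun k => ∀ u ∈ S, ∀ v ∈ S, G.Adj u v → k u ≠ k v

theorem mem_partialColorings {n : ℕ} {S : Finset V} {k : V → ℕ} :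
    k ∈ partialColorings G n S ↔ ((∀ v ∈ S, k v < n) ∧ ∀ v ∉ S, k v = 0) ∧
      ∀ u ∈ S, ∀ v ∈ S, G.Adj u v → k u ≠ k v := by
  rw [partialColorings, Finset.mem_filter, Fintype.mem_piFinset]
  refine and_congr_left fun _ => ⟨fun h => ⟨fun v hv => ?_, fun v hv => ?_⟩, fun h v => ?_⟩
  · simpa [hv] using h v
  · simpa [hv] using h v
  · split_ifs with hv
    · simpa using h.1 v hv
    · simpa using h.2 v hv

/-- The class of the last colour must be independent, and the other vertices are coloured with the
remaining `n` colours. -/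
theorem card_fiber_partialColorings (n : ℕ) {S T : Finset V} (hT : T ⊆ S) :
    (((partialColorings G (n + 1) S).filter fun k => S.filter (fun v => k v = n) = T).card : ℤ) =
      indep G T * (partialColorings G n (S \ T)).card := by
  by_cases hI : ∀ u ∈ T, ∀ v ∈ T, ¬ G.Adj u v
  · rw [indep, if_pos hI, one_mul, Nat.cast_inj]
    refine Finset.card_nbij' (fun k v => if v ∈ T then 0 else k v)
      (fun k v => if v ∈ T then n else k v) ?_ ?_ ?_ ?_
    · intro k hk
      rw [Finset.mem_coe, Finset.mem_filter, mem_partialColorings] at hk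
      obtain ⟨⟨⟨h1, h2⟩, h3⟩, h4⟩ := hk
      have h5 : ∀ v ∈ S, k v = n ↔ v ∈ T := fun v hv => by rw [← h4]; simp [hv]
      rw [Finset.mem_coe, mem_partialColorings]
      refine ⟨⟨fun v hv => ?_, fun v hv => ?_⟩, fun u hu v hv huv => ?_⟩
      · rw [Finset.mem_sdiff] at hv
        have := h1 v hv.1
        have := (h5 v hv.1).not.2 hv.2
        simp only [hv.2, if_false]
        omega
      · rw [Finset.mem_sdiff, not_and_not_right] at hv
        by_cases hvT : v ∈ T
        · simp [hvT]
        · simpa [hvT] using h2 v fun h => hvT (hv h)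
      · rw [Finset.mem_sdiff] at hu hv
        simpa [hu.2, hv.2] using h3 u hu.1 v hv.1 huv
    · intro k hk
      rw [Finset.mem_coe, mem_partialColorings] at hk
      obtain ⟨⟨h1, h2⟩, h3⟩ := hk
      rw [Finset.mem_coe, Finset.mem_filter, mem_partialColorings]
      have h6 : ∀ v ∈ S, v ∉ T → k v < n := fun v hv hvT => h1 v (Finset.mem_sdiff.2 ⟨hv, hvT⟩)
      refine ⟨⟨⟨fun v hv => ?_, fun v hv => ?_⟩, fun u hu v hv huv => ?_⟩, ?_⟩ <;> beta_reduce
      · split_ifs with hvT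
        · omega
        · have := h6 v hv hvT
          omega
      · rw [if_neg fun h => hv (hT h)]
        exact h2 v fun h => hv (Finset.mem_sdiff.1 h).1
      · split_ifs with huT hvT hvT
        · exact absurd huv (hI u huT v hvT)
        · exact (h6 v hv hvT).ne'
        · exact (h6 u hu huT).ne
        · exact h3 u (Finset.mem_sdiff.2 ⟨hu, huT⟩) v (Finset.mem_sdiff.2 ⟨hv, hvT⟩) huv
      · ext v
        rw [Finset.mem_filter]
        constructor
        · rintro ⟨hv, h⟩
          by_contra hvT
          rw [if_neg hvT] at h
          exact (h6 v hv hvT).ne h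
        · intro hvT
          exact ⟨hT hvT, if_pos hvT⟩
    · intro k hk
      rw [Finset.mem_coe, Finset.mem_filter] at hk
      funext v
      by_cases hv : v ∈ T
      · have : v ∈ S.filter (fun v => k v = n) := by rw [hk.2]; exact hv
        simp [hv, (Finset.mem_filter.1 this).2]
      · simp [hv]
    · intro k hk
      rw [Finset.mem_coe, mem_partialColorings] at hk
      funext v
      by_cases hv : v ∈ T
      · simp only [hv, if_true]
        exact (hk.1.2 v fun h => (Finset.mem_sdiff.1 h).2 hv).symm
      · simp [hv]
  · rw [indep, if_neg hI, zero_mul, Nat.cast_eq_zero, Finset.card_eq_zero,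
      Finset.filter_eq_empty_iff]
    rintro k hk rfl
    refine hI fun u hu v hv huv => ?_
    rw [Finset.mem_filter] at hu hv
    exact (mem_partialColorings G |>.1 hk).2 u hu.1 v hv.1 huv (hu.2.trans hv.2.symm)

/-- Splitting off the last colour class convolves with `indep`, the exponential of `connWeight`; by
`setExp_add`, each colour adds one copy of `connWeight` to the exponent. -/
theorem card_partialColorings (n : ℕ) (S : Finset V) :
    ((partialColorings G n S).card : ℤ) = setExp (fun B => n * connWeight G B) S := by
  induction n generalizing S with
  | zero =>
    simp only [Nat.cast_zero, zero_mul]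
    rcases S.eq_empty_or_nonempty with rfl | hS
    · rw [setExp_empty, Nat.cast_eq_one, Finset.card_eq_one]
      refine ⟨0, ?_⟩
      ext k
      rw [mem_partialColorings]
      simp [funext_iff]
    · rw [setExp_zero _ hS, Nat.cast_eq_zero, Finset.card_eq_zero]
      obtain ⟨v, hv⟩ := hS
      refine Finset.eq_empty_of_forall_notMem fun k hk => ?_
      exact absurd (((mem_partialColorings G).1 hk).1.1 v hv) (Nat.not_lt_zero _)
  | succ n ih =>
    rw [Finset.card_eq_sum_card_fiberwise (f := fun k : V → ℕ => S.filter fun v => k v = n)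
      (t := S.powerset) fun k _ =>
        Finset.mem_coe.2 (Finset.mem_powerset.2 (Finset.filter_subset _ _)), Nat.cast_sum]
    rw [setExp_congr (ψ := fun B => connWeight G B + n * connWeight G B) fun B _ _ => by
      push_cast; ring, setExp_add]
    refine Finset.sum_congr rfl fun T hT => ?_
    rw [card_fiber_partialColorings G n (Finset.mem_powerset.1 hT), ih, setExp_connWeight]

theorem natCard_coloring (n : ℕ) :
    (Nat.card (G.Coloring (Fin n)) : ℤ) =
      setExp (fun B => n * connWeight G B) Finset.univ := by
  rw [← card_partialColorings, Nat.cast_inj, ← Nat.card_eq_finsetCard]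
  refine Nat.card_congr
    { toFun := fun k => ⟨fun v => k v, (mem_partialColorings G).2
        ⟨⟨fun v _ => (k v).2, fun v hv => absurd (Finset.mem_univ v) hv⟩,
          fun u _ v _ huv h => k.valid huv (Fin.ext h)⟩⟩
      invFun := fun k => SimpleGraph.Coloring.mk
        (fun v => ⟨k.1 v, ((mem_partialColorings G).1 k.2).1.1 v (Finset.mem_univ v)⟩)
        fun {u v} huv h => ((mem_partialColorings G).1 k.2).2 u (Finset.mem_univ u) v
          (Finset.mem_univ v) huv (Fin.mk.inj_iff.1 h)
      left_inv := fun k => rfl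
      right_inv := fun k => rfl }

theorem aeval_chromaticPolynomial (q : ℂ) :
    aeval q (ChromaticZeros.chromaticPolynomial G) =
      setExp (fun B => q * (connWeight G B : ℂ)) Finset.univ := by
  have : ChromaticZeros.chromaticPolynomial G =
      setExp (fun B => (X : ℤ[X]) * Polynomial.C (connWeight G B)) Finset.univ := by
    -- The two polynomials agree at every natural number, hence are equal; this carries the count to
    -- complex `q`.
    refine Polynomial.eq_of_infinite_eval_eq _ _ (Set.Infinite.mono ?_
      (Set.infinite_range_of_injective (Nat.cast_injective (R := ℤ))))
    rintro _ ⟨n, rfl⟩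
    rw [Set.mem_ofPred_eq, ChromaticZeros.eval_chromaticPolynomial, natCard_coloring,
      ← Polynomial.coe_evalRingHom, map_setExp]
    simp
  rw [this]
  have h := map_setExp (aeval (R := ℤ) q).toRingHom
    (fun B => (X : ℤ[X]) * Polynomial.C (connWeight G B)) Finset.univ
  rw [AlgHom.toRingHom_eq_coe, AlgHom.coe_toRingHom] at h
  rw [h]
  simp

end Chromatic

/-! ### Bounds for the weights of blocks through one or two vertices. -/

section Bounds

variable {V : Type*} [DecidableEq V]

/-- The weighted sum over the blocks `B ⊆ H` that contain both `v` and `w`. -/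
def pairSum (c : Finset V → ℝ) (s : ℝ) (H : Finset V) (v w : V) : ℝ :=
  ∑ B ∈ H.powerset with v ∈ B ∧ w ∈ B, c B * s ^ (B.card - 1)

/-- The weighted sum over the collections of disjoint blocks in `H` that all meet `W`. -/
noncomputable def attachSum (W : Finset V) (c : Finset V → ℝ) (s : ℝ) (H : Finset V) : ℝ :=
  ∑ B ∈ H.powerset, setExp (touching W c) B * s ^ B.card

theorem sum_powerset_filter_insert {M : Type*} [AddCommMonoid M] {H : Finset V} {w : V}
    (hw : w ∉ H) (p : Finset V → Prop) [DecidablePred p] (h : Finset V → M)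
    (hp : ∀ B, p B → w ∈ B) :
    ∑ B ∈ (insert w H).powerset with p B, h B =
      ∑ B ∈ H.powerset with p (insert w B), h (insert w B) := by
  rw [Finset.sum_filter, Finset.sum_filter, Finset.sum_powerset_insert hw]
  convert zero_add _
  refine Finset.sum_eq_zero fun B hB => if_neg fun h => hw (Finset.mem_powerset.1 hB (hp B h))

theorem sum_setExp_insert {R : Type*} [CommRing R] (φ : Finset V → R) (r : R) {H : Finset V}
    {w : V} (hw : w ∉ H) :
    ∑ D ∈ H.powerset, setExp φ (insert w D) * r ^ (D.card + 1) =
      ∑ C ∈ H.powerset, φ (insert w C) * r ^ (C.card + 1) *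
        ∑ D ∈ (H \ C).powerset, setExp φ D * r ^ D.card := by
  simp only [Finset.mul_sum]
  rw [← sum_powerset_assoc H fun A B _ =>
    φ (insert w A) * r ^ (A.card + 1) * (setExp φ B * r ^ B.card)]
  refine Finset.sum_congr rfl fun D hD => ?_
  rw [setExp_insert _ fun h => hw (Finset.mem_powerset.1 hD h), Finset.sum_mul]
  refine Finset.sum_congr rfl fun C hC => ?_
  rw [← Finset.card_sdiff_add_card_eq_card (Finset.mem_powerset.1 hC)]
  ring

variable {c : Finset V → ℝ} {s : ℝ}

theorem touching_nonneg (hc0 : ∀ B : Finset V, B.Nonempty → 0 ≤ c B) (W : Finset V) {B : Finset V}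
    (hB : B.Nonempty) : 0 ≤ touching W c B := by
  rw [touching]
  split_ifs
  exacts [hc0 B hB, le_rfl]

theorem pairSum_mono (hc0 : ∀ B : Finset V, B.Nonempty → 0 ≤ c B) (hs : 0 ≤ s)
    {H H' : Finset V} (h : H ⊆ H') (v w : V) : pairSum c s H v w ≤ pairSum c s H' v w := by
  refine Finset.sum_le_sum_of_subset_of_nonneg
    (Finset.filter_subset_filter _ (Finset.powerset_mono.2 h)) fun B hB _ => ?_
  exact mul_nonneg (hc0 B ⟨v, (Finset.mem_filter.1 hB).2.1⟩) (pow_nonneg hs _)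

theorem pairSum_nonneg (hc0 : ∀ B : Finset V, B.Nonempty → 0 ≤ c B) (hs : 0 ≤ s)
    (H : Finset V) (v w : V) : 0 ≤ pairSum c s H v w :=
  Finset.sum_nonneg fun B hB =>
    mul_nonneg (hc0 B ⟨v, (Finset.mem_filter.1 hB).2.1⟩) (pow_nonneg hs _)

theorem attachSum_mono (hc0 : ∀ B : Finset V, B.Nonempty → 0 ≤ c B) (hs : 0 ≤ s)
    (W : Finset V) {H H' : Finset V} (h : H ⊆ H') : attachSum W c s H ≤ attachSum W c s H' :=
  Finset.sum_le_sum_of_subset_of_nonneg (Finset.powerset_mono.2 h) fun _ _ _ =>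
    mul_nonneg (setExp_nonneg fun _ _ hB => touching_nonneg hc0 W hB) (pow_nonneg hs _)

theorem touching_insert_of_notMem {R : Type*} [CommRing R] (φ : Finset V → R) (W : Finset V)
    {w : V} {B : Finset V} (hw : w ∉ B) : touching (insert w W) φ B = touching W φ B := by
  rw [touching, touching, Finset.inter_insert_of_notMem hw]

theorem setExp_touching_insert {R : Type*} [CommRing R] (φ : Finset V → R) (W : Finset V)
    {w : V} {S : Finset V} (hw : w ∉ S) :
    setExp (touching (insert w W) φ) S = setExp (touching W φ) S :=
  setExp_congr fun _ hB _ => touching_insert_of_notMem φ W fun h => hw (hB h)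

theorem attachSum_insert_of_notMem (W : Finset V) {w : V} {H : Finset V} (hw : w ∉ H) :
    attachSum (insert w W) c s H = attachSum W c s H :=
  Finset.sum_congr rfl fun B hB => by
    rw [setExp_touching_insert _ _ fun h => hw (Finset.mem_powerset.1 hB h)]

theorem pairSum_insert_self {w : V} {H : Finset V} (hw : w ∉ H) :
    pairSum c s (insert w H) w w = ∑ B ∈ H.powerset, c (insert w B) * s ^ B.card := by
  rw [pairSum, sum_powerset_filter_insert hw _ _ fun B h => h.1, Finset.filter_true_of_mem
    fun B _ => by simp]
  refine Finset.sum_congr rfl fun B hB => ?_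
  rw [Finset.card_insert_of_notMem fun h => hw (Finset.mem_powerset.1 hB h), Nat.add_sub_cancel]

/-- Enlarging `W` by `w` matters only for collections covering `w`. Split off the block of `w`: its
weight is counted by `s` times `pairSum` at `w`, and the other blocks must still meet `W`. -/
theorem attachSum_insert_le (hc0 : ∀ B : Finset V, B.Nonempty → 0 ≤ c B) (hs : 0 ≤ s)
    (W : Finset V) {w : V} {H : Finset V} (hw : w ∈ H) :
    attachSum (insert w W) c s H ≤ attachSum W c s H * (1 + s * pairSum c s H w w) := by
  obtain ⟨H, hw', rfl⟩ : ∃ H', w ∉ H' ∧ H = insert w H' :=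
    ⟨H.erase w, Finset.notMem_erase _ _, (Finset.insert_erase hw).symm⟩
  have h0 := attachSum_mono hc0 hs W (Finset.subset_insert w H)
  have hp := pairSum_nonneg hc0 hs (insert w H) w w
  refine le_trans ?_ (mul_le_mul_of_nonneg_right h0 (by positivity))
  have h1 : attachSum (insert w W) c s (insert w H) = attachSum (insert w W) c s H +
      ∑ D ∈ H.powerset, setExp (touching (insert w W) c) (insert w D) * s ^ (D.card + 1) := by
    rw [attachSum, Finset.sum_powerset_insert hw']
    congr 1
    refine Finset.sum_congr rfl fun D hD => ?_
    rw [Finset.card_insert_of_notMem fun h => hw' (Finset.mem_powerset.1 hD h)]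
  rw [h1, sum_setExp_insert _ _ hw', attachSum_insert_of_notMem W hw', mul_add, mul_one,
    pairSum_insert_self hw', Finset.mul_sum, Finset.mul_sum]
  refine add_le_add le_rfl (Finset.sum_le_sum fun C _ => ?_)
  have h2 : touching (insert w W) c (insert w C) = c (insert w C) :=
    if_pos ⟨w, by simp⟩
  have h3 : ∑ D ∈ (H \ C).powerset, setExp (touching (insert w W) c) D * s ^ D.card =
      attachSum W c s (H \ C) :=
    attachSum_insert_of_notMem W fun h => hw' (Finset.mem_sdiff.1 h).1
  rw [h2, h3]
  have := hc0 _ (Finset.insert_nonempty w C)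
  calc _ ≤ c (insert w C) * s ^ (C.card + 1) * attachSum W c s H :=
        mul_le_mul_of_nonneg_left (attachSum_mono hc0 hs W Finset.sdiff_subset) (by positivity)
    _ = _ := by ring

theorem attachSum_empty (H : Finset V) : attachSum ∅ c s H = 1 := by
  rw [attachSum, Finset.sum_eq_single ∅]
  · simp
  · intro B _ hB
    have : touching ∅ c = fun _ => (0 : ℝ) := by ext B; simp [touching]
    rw [this, setExp_zero _ (Finset.nonempty_iff_ne_empty.2 hB), zero_mul]
  · simp

theorem attachSum_le (hc0 : ∀ B : Finset V, B.Nonempty → 0 ≤ c B) (hs : 0 ≤ s) {Y : ℝ}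
    (hY0 : 0 ≤ Y) {H : Finset V} (W : Finset V) (hY : ∀ w ∈ W ∩ H, pairSum c s H w w ≤ Y) :
    attachSum W c s H ≤ (1 + s * Y) ^ (W ∩ H).card := by
  induction W using Finset.induction_on with
  | empty => simp [attachSum_empty]
  | insert w W hw ih =>
  have ih := ih fun v hv => hY v
    (Finset.inter_subset_inter_right (Finset.subset_insert w W) hv)
  by_cases hwH : w ∈ H
  · rw [Finset.insert_inter_of_mem hwH, Finset.card_insert_of_notMem
      fun h => hw (Finset.mem_inter.1 h).1, pow_succ]
    have := hY w (by simp [hwH])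
    have := pairSum_nonneg hc0 hs H w w
    refine (attachSum_insert_le hc0 hs W hwH).trans (mul_le_mul ih ?_ ?_ ?_)
    · gcongr
    · positivity
    · positivity
  · rwa [attachSum_insert_of_notMem W hwH, Finset.insert_inter_of_notMem hwH]

variable [Fintype V] (G : SimpleGraph V) [DecidableRel G.Adj]

theorem pairSum_self_eq_attachSum
    (hc : ∀ v S, v ∉ S → c (insert v S) = setExp (touching (G.neighborFinset v) c) S)
    {w : V} {H : Finset V} (hw : w ∈ H) :
    pairSum c s H w w = attachSum (G.neighborFinset w) c s (H.erase w) := by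
  conv_lhs => rw [← Finset.insert_erase hw]
  rw [pairSum_insert_self (Finset.notMem_erase _ _)]
  refine Finset.sum_congr rfl fun B hB => ?_
  rw [hc]
  exact fun h => Finset.notMem_erase w H (Finset.mem_powerset.1 hB h)

theorem neighborFinset_inter_erase (v : V) (H : Finset V) :
    G.neighborFinset v ∩ H.erase v = G.neighborFinset v ∩ H := by
  ext w
  simp only [Finset.mem_inter, SimpleGraph.mem_neighborFinset, Finset.mem_erase]
  exact ⟨fun h => ⟨h.1, h.2.2⟩, fun h => ⟨h.1, h.1.ne', h.2⟩⟩

/-- Deleting `w` from its block leaves blocks attached to the neighbours of `w`. Each such neighbour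
has lost `w`, so at most `D` neighbours remain to it and the inductive bound there is `(1 + s Y)^D ≤
Y`. -/
theorem pairSum_self_le (hc0 : ∀ B : Finset V, B.Nonempty → 0 ≤ c B)
    (hc : ∀ v S, v ∉ S → c (insert v S) = setExp (touching (G.neighborFinset v) c) S)
    (hs : 0 ≤ s) {Y : ℝ} (hY0 : 0 ≤ Y) {D : ℕ} (hD : ∀ v, G.degree v ≤ D + 1)
    (hY : (1 + s * Y) ^ D ≤ Y) {H : Finset V} {w : V} (hw : w ∈ H) :
    pairSum c s H w w ≤ (1 + s * Y) ^ (G.neighborFinset w ∩ H).card := by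
  induction H using Finset.strongInduction generalizing w with
  | H H ih =>
  rw [pairSum_self_eq_attachSum G hc hw, ← neighborFinset_inter_erase]
  refine attachSum_le hc0 hs hY0 _ fun v hv => ?_
  rw [Finset.mem_inter, SimpleGraph.mem_neighborFinset] at hv
  refine (ih _ (Finset.erase_ssubset hw) hv.2).trans (le_trans ?_ hY)
  refine pow_le_pow_right₀ (le_add_of_nonneg_right (by positivity)) ?_
  refine Nat.lt_succ_iff.1 (lt_of_lt_of_le (Finset.card_lt_card ?_) (hD v))
  rw [Finset.ssubset_iff]
  refine ⟨w, by simp, Finset.insert_subset ?_ Finset.inter_subset_left⟩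
  simpa using hv.1.symm

/-- Delete `v` from the block: the piece containing `w` holds some neighbour `z` of `v`, which gives
the sum over `z`. The other pieces attach to the remaining neighbours only, hence the exponent
reduced by one. -/
theorem pairSum_le_sum_neighbors (hc0 : ∀ B : Finset V, B.Nonempty → 0 ≤ c B)
    (hc : ∀ v S, v ∉ S → c (insert v S) = setExp (touching (G.neighborFinset v) c) S)
    (hs : 0 ≤ s) {Y : ℝ} (hY0 : 0 ≤ Y) {H : Finset V} {v w : V} (hv : v ∈ H) (hw : w ∈ H)
    (hvw : v ≠ w)
    (hY : ∀ z ∈ G.neighborFinset v ∩ H, pairSum c s (H.erase v) z z ≤ Y) :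
    pairSum c s H v w ≤ s * (1 + s * Y) ^ ((G.neighborFinset v ∩ H).card - 1) *
      ∑ z ∈ G.neighborFinset v ∩ H, pairSum c s (H.erase v) z w := by
  obtain ⟨H, hwH, hvH, rfl⟩ : ∃ H', w ∉ H' ∧ v ∉ insert w H' ∧ H = insert v (insert w H') := by
    have : w ∈ H.erase v := Finset.mem_erase.2 ⟨hvw.symm, hw⟩
    refine ⟨(H.erase v).erase w, Finset.notMem_erase _ _, ?_, ?_⟩
    · rw [Finset.insert_erase this]; exact Finset.notMem_erase _ _
    · rw [Finset.insert_erase this, Finset.insert_erase hv]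
  rw [Finset.erase_insert hvH] at hY ⊢
  set N := G.neighborFinset v with hN
  set m := (N ∩ insert v (insert w H)).card with hm
  have h1 : pairSum c s (insert v (insert w H)) v w =
      ∑ C ∈ H.powerset, touching N c (insert w C) * s ^ (C.card + 1) *
        attachSum N c s (H \ C) := by
    rw [pairSum, sum_powerset_filter_insert hvH _ _ fun B h => h.1,
      sum_powerset_filter_insert hwH _ _ fun B h => ?_, Finset.filter_true_of_mem
      fun B _ => by simp]
    · simp only [attachSum]
      rw [← sum_setExp_insert _ _ hwH]
      refine Finset.sum_congr rfl fun C hC => ?_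
      have hwC : w ∉ C := fun h => hwH (Finset.mem_powerset.1 hC h)
      have hvC : v ∉ insert w C := fun h =>
        hvH (Finset.insert_subset_insert w (Finset.mem_powerset.1 hC) h)
      rw [hc _ _ hvC, Finset.card_insert_of_notMem hvC, Finset.card_insert_of_notMem hwC,
        Nat.add_sub_cancel]
    · exact (Finset.mem_insert.1 h.2).resolve_left hvw.symm
  have h2 : ∀ z, pairSum c s (insert w H) z w =
      ∑ C ∈ H.powerset, if z ∈ insert w C then c (insert w C) * s ^ C.card else 0 := by
    intro z
    rw [pairSum, sum_powerset_filter_insert hwH _ _ fun B h => h.2, Finset.sum_filter]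
    refine Finset.sum_congr rfl fun C hC => ?_
    have hwC : w ∉ C := fun h => hwH (Finset.mem_powerset.1 hC h)
    rw [Finset.card_insert_of_notMem hwC, Nat.add_sub_cancel]
    simp
  rw [h1, Finset.sum_congr (s₁ := N ∩ _) rfl fun z _ => h2 z, Finset.sum_comm, Finset.mul_sum]
  refine Finset.sum_le_sum fun C hC => ?_
  rw [Finset.mem_powerset] at hC
  have hcC := hc0 _ (Finset.insert_nonempty w C)
  have hnn : ∀ z ∈ N ∩ insert v (insert w H),
      0 ≤ if z ∈ insert w C then c (insert w C) * s ^ C.card else 0 := by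
    intro z _
    split_ifs
    exacts [by positivity, le_rfl]
  rw [touching]
  split_ifs with h
  · obtain ⟨z, hz⟩ := h
    rw [Finset.mem_inter] at hz
    have hzH : z ∈ insert w H := Finset.insert_subset_insert w hC hz.1
    have hz' : z ∈ N ∩ insert v (insert w H) :=
      Finset.mem_inter.2 ⟨hz.2, Finset.mem_insert_of_mem hzH⟩
    have h3 : attachSum N c s (H \ C) ≤ (1 + s * Y) ^ (m - 1) := by
      have hsub : H \ C ⊆ insert w H := Finset.sdiff_subset.trans (Finset.subset_insert _ _)
      refine (attachSum_le hc0 hs hY0 N fun u hu => ?_).trans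
        (pow_le_pow_right₀ (le_add_of_nonneg_right (by positivity)) (Nat.le_sub_one_of_lt
          (Finset.card_lt_card (Finset.ssubset_iff.2 ⟨z, ?_, Finset.insert_subset hz' ?_⟩))))
      · rw [Finset.mem_inter] at hu
        exact (pairSum_mono hc0 hs hsub u u).trans
          (hY u (Finset.mem_inter.2 ⟨hu.1, Finset.mem_insert_of_mem (hsub hu.2)⟩))
      · intro hz''
        rw [Finset.mem_inter, Finset.mem_sdiff] at hz''
        rcases Finset.mem_insert.1 hz.1 with rfl | h
        exacts [hwH hz''.2.1, hz''.2.2 h]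
      · exact Finset.inter_subset_inter_left (hsub.trans (Finset.subset_insert _ _))
    have h4 := Finset.single_le_sum hnn hz'
    rw [if_pos hz.1] at h4
    calc c (insert w C) * s ^ (C.card + 1) * attachSum N c s (H \ C)
        ≤ c (insert w C) * s ^ (C.card + 1) * (1 + s * Y) ^ (m - 1) :=
          mul_le_mul_of_nonneg_left h3 (by positivity)
      _ = s * (1 + s * Y) ^ (m - 1) * (c (insert w C) * s ^ C.card) := by ring
      _ ≤ _ := mul_le_mul_of_nonneg_left h4 (by positivity)
  · rw [zero_mul, zero_mul]
    exact mul_nonneg (by positivity) (Finset.sum_nonneg hnn)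

/-- All paths from `v` to `w` inside `H` have length at least `d`. -/
def Far (H : Finset V) (v w : V) (d : ℕ) : Prop :=
  ∀ p : G.Walk v w, p.IsPath → (∀ z ∈ p.support, z ∈ H) → d ≤ p.length

/-- Iterating `pairSum_le_sum_neighbors` follows paths from `v` to `w`: each step costs `p`, the
final return at `w` costs `Y`, and there are at most `D^(k-1)` choices for `k` steps. Summing `Y
D^(k-1) p^k` over `k ≥ d + 1` gives the bound. -/
theorem pairSum_le_of_far (hc0 : ∀ B : Finset V, B.Nonempty → 0 ≤ c B)
    (hc : ∀ v S, v ∉ S → c (insert v S) = setExp (touching (G.neighborFinset v) c) S)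
    (hs : 0 ≤ s) {Y : ℝ} (hY0 : 0 ≤ Y) {D : ℕ} (hD : ∀ v, G.degree v ≤ D + 1)
    (hY : (1 + s * Y) ^ D ≤ Y) {p : ℝ} (hp : p = s * (1 + s * Y) ^ (D - 1)) (hDp : D * p < 1)
    {H : Finset V} {v w : V} (hv : v ∈ H) (hw : w ∈ H) (hvw : v ≠ w)
    (hvD : (G.neighborFinset v ∩ H).card ≤ D) (hwD : (G.neighborFinset w ∩ H).card ≤ D)
    {d : ℕ} (hd : Far G H v w (d + 1)) :
    pairSum c s H v w ≤ Y * p * (D * p) ^ d / (1 - D * p) := by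
  have hp0 : 0 ≤ p := by rw [hp]; positivity
  have h1 : 0 < 1 - D * p := by linarith
  induction H using Finset.strongInduction generalizing v d with
  | H H ih =>
  set N := G.neighborFinset v ∩ H with hN
  have hNdeg : ∀ z ∈ N, (G.neighborFinset z ∩ H.erase v).card ≤ D := by
    intro z hz
    rw [hN, Finset.mem_inter, SimpleGraph.mem_neighborFinset] at hz
    refine Nat.lt_succ_iff.1 (lt_of_lt_of_le (Finset.card_lt_card ?_) (hD z))
    rw [Finset.ssubset_iff]
    refine ⟨v, by simp, Finset.insert_subset ?_ Finset.inter_subset_left⟩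
    simpa using hz.1.symm
  have hNH : ∀ z ∈ N, z ∈ H.erase v := by
    intro z hz
    rw [hN, Finset.mem_inter, SimpleGraph.mem_neighborFinset] at hz
    exact Finset.mem_erase.2 ⟨hz.1.ne', hz.2⟩
  have hself : ∀ z ∈ H.erase v, (G.neighborFinset z ∩ H.erase v).card ≤ D →
      pairSum c s (H.erase v) z z ≤ Y := fun z hz hzD =>
    (pairSum_self_le G hc0 hc hs hY0 hD hY hz).trans
      ((pow_le_pow_right₀ (le_add_of_nonneg_right (by positivity)) hzD).trans hY)
  have hwD' : (G.neighborFinset w ∩ H.erase v).card ≤ D :=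
    (Finset.card_le_card (Finset.inter_subset_inter_left (Finset.erase_subset _ _))).trans hwD
  have hw' : w ∈ H.erase v := Finset.mem_erase.2 ⟨hvw.symm, hw⟩
  have hstep : ∀ Q : ℝ, (∀ z ∈ N, pairSum c s (H.erase v) z w ≤ Q) → 0 ≤ Q →
      ∑ z ∈ N, pairSum c s (H.erase v) z w ≤ D * Q := by
    intro Q hQ hQ0
    refine (Finset.sum_le_card_nsmul _ _ _ hQ).trans ?_
    rw [nsmul_eq_mul]
    exact mul_le_mul_of_nonneg_right (Nat.cast_le.2 hvD) hQ0
  have hrec : pairSum c s H v w ≤ p * ∑ z ∈ N, pairSum c s (H.erase v) z w := by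
    refine (pairSum_le_sum_neighbors G hc0 hc hs hY0 hv hw hvw
      fun z hz => hself z (hNH z hz) (hNdeg z hz)).trans (mul_le_mul_of_nonneg_right ?_
        (Finset.sum_nonneg fun z _ => pairSum_nonneg hc0 hs _ _ _))
    rw [hp]
    exact mul_le_mul_of_nonneg_left
      (pow_le_pow_right₀ (le_add_of_nonneg_right (by positivity)) (Nat.sub_le_sub_right hvD 1)) hs
  have hfar : ∀ z ∈ N, ∀ q : G.Walk z w, q.IsPath → (∀ u ∈ q.support, u ∈ H.erase v) →
      d ≤ q.length := by
    intro z hz q hq hqH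
    rw [hN, Finset.mem_inter, SimpleGraph.mem_neighborFinset] at hz
    have := hd (SimpleGraph.Walk.cons hz.1 q) (hq.cons fun h => Finset.notMem_erase v H (hqH v h))
      (by
        intro u hu
        rw [SimpleGraph.Walk.support_cons, List.mem_cons] at hu
        rcases hu with rfl | hu
        exacts [hv, Finset.mem_of_mem_erase (hqH u hu)])
    simpa using this
  have hind : ∀ e : ℕ, (∀ z ∈ N, z ≠ w → Far G (H.erase v) z w (e + 1)) →
      ∀ z ∈ N, z ≠ w → pairSum c s (H.erase v) z w ≤ Y * p * (D * p) ^ e / (1 - D * p) :=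
    fun e he z hz hzw => ih _ (Finset.erase_ssubset hv) (hNH z hz) hw' hzw (hNdeg z hz) hwD'
      (he z hz hzw)
  rcases d with _ | d
  · set Q := Y * p * (D * p) ^ 0 / (1 - D * p) with hQ
    have hQ0 : 0 ≤ Q := by positivity
    -- `Q` is the fixed point of the recursion: at most `D` neighbours contribute `Q` each, and `w`
    -- itself, if it is a neighbour, contributes at most `Y`.
    have hQe : Q = p * (D * Q + Y) := by
      have : Q * (1 - D * p) = Y * p := by
        rw [hQ, pow_zero, mul_one, div_mul_cancel₀ _ h1.ne']
      linarith
    have h2 := hind 0 fun z hz hzw q hq hqH => by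
      rw [zero_add, Nat.one_le_iff_ne_zero]
      exact fun h => hzw (SimpleGraph.Walk.eq_of_length_eq_zero h)
    refine hrec.trans ?_
    rw [hQe]
    refine mul_le_mul_of_nonneg_left ?_ hp0
    calc ∑ z ∈ N, pairSum c s (H.erase v) z w
        ≤ ∑ z ∈ N, (Q + if z = w then Y else 0) := by
          refine Finset.sum_le_sum fun z hz => ?_
          split_ifs with hzw
          · rw [hzw]
            linarith [hself w hw' hwD']
          · linarith [h2 z hz hzw]
      _ ≤ D * Q + Y := by
          rw [Finset.sum_add_distrib, Finset.sum_const, nsmul_eq_mul, Finset.sum_ite_eq']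
          refine add_le_add (mul_le_mul_of_nonneg_right (Nat.cast_le.2 hvD) hQ0) ?_
          split_ifs
          exacts [le_rfl, hY0]
  -- Here the distance is at least two, so `w` is not a neighbour and the term `Y` does not occur.
  · have hwN : ∀ z ∈ N, z ≠ w := by
      rintro z hz rfl
      have := hfar z hz SimpleGraph.Walk.nil (by simp) (by simpa using hw')
      simp at this
    have h2 := hind d fun z hz _ => hfar z hz
    refine hrec.trans ((mul_le_mul_of_nonneg_left
      (hstep _ (fun z hz => h2 z hz (hwN z hz)) (by positivity)) hp0).trans (le_of_eq ?_))
    rw [pow_succ]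
    ring

end Bounds

/-- Such a path, closed up through `u`, is a cycle with two more edges. -/
theorem far_of_le_egirth {V : Type*} (G : SimpleGraph V) {e : ℕ}
    (hg : ((e + 3 : ℕ) : ℕ∞) ≤ G.egirth) (S : Finset V) (u v w : V)
    (hu : u ∉ S) (huv : G.Adj u v) (huw : G.Adj u w) (hvw : v ≠ w) : Far G S v w (e + 1) := by
  intro p hp hpS
  have hup : u ∉ p.support := fun h => hu (hpS u h)
  have hcyc : (SimpleGraph.Walk.cons huv (p.concat huw.symm)).IsCycle := by
    rw [SimpleGraph.Walk.cons_isCycle_iff]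
    refine ⟨hp.concat hup huw.symm, fun h => ?_⟩
    rw [SimpleGraph.Walk.edges_concat, List.concat_eq_append, List.mem_append,
      List.mem_singleton] at h
    rcases h with h | h
    · exact hup (SimpleGraph.Walk.fst_mem_support_of_mem_edges p h)
    · rw [Sym2.eq_iff] at h
      rcases h with h | h
      exacts [huw.ne h.1, hvw h.2]
  have := SimpleGraph.le_egirth.1 hg u _ hcyc
  rw [SimpleGraph.Walk.length_cons, SimpleGraph.Walk.length_concat, Nat.cast_le] at this
  omega

/-! ### The induction showing that adding a vertex changes the normalized polynomial little. -/

section Main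

variable {V : Type*} [DecidableEq V] {c : Finset V → ℝ} {x : ℂ}

/-- The normalized weight of a block in the chromatic polynomial. -/
noncomputable def blockWeight (c : Finset V → ℝ) (x : ℂ) (B : Finset V) : ℂ :=
  (c B : ℂ) * x ^ (B.card - 1)

/-- The normalized chromatic polynomial of `S` with a new vertex that is joined to `W`. -/
noncomputable def coneExp (W : Finset V) (c : Finset V → ℝ) (x : ℂ) (S : Finset V) : ℂ :=
  setExp (fun B => touching W (fun B => x * blockWeight c x B) B + blockWeight c x B) S

theorem setExp_touching_blockWeight (W T : Finset V) :
    setExp (touching W fun B => x * blockWeight c x B) T =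
      ((setExp (touching W c) T : ℝ) : ℂ) * x ^ T.card := by
  rw [← Complex.ofRealHom_eq_coe, map_setExp, mul_comm, ← setExp_pow_card_mul]
  refine setExp_congr fun B _ hB => ?_
  have := Nat.succ_pred_eq_of_pos (Finset.card_pos.2 hB)
  rw [touching, touching, blockWeight]
  split_ifs
  · rw [← this, pow_succ]
    simp
    ring
  · simp

theorem coneExp_eq_sum (W S : Finset V) :
    coneExp W c x S = ∑ R ∈ S.powerset,
      ((setExp (touching W c) R : ℝ) : ℂ) * x ^ R.card * setExp (blockWeight c x) (S \ R) := by
  rw [coneExp, setExp_add]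
  simp only [setExp_touching_blockWeight]

theorem coneExp_empty (S : Finset V) : coneExp ∅ c x S = setExp (blockWeight c x) S := by
  refine setExp_congr fun B _ _ => ?_
  simp [touching]

theorem coneExp_insert_of_notMem (W : Finset V) {w : V} {S : Finset V} (hw : w ∉ S) :
    coneExp (insert w W) c x S = coneExp W c x S := by
  refine setExp_congr fun B hB _ => ?_
  rw [touching_insert_of_notMem _ _ fun h => hw (hB h)]

/-- The block of `w` carries the factor `1 + x` for `insert w W`. For `W` it carries `1`, or `1 + x`
if the block already meets `W`; in that case `(1 + x)` times the second expansion overshoots by `x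
(1 + x)`, which is the subtracted sum. -/
theorem coneExp_insert (W : Finset V) {w : V} {S : Finset V} (hw : w ∉ S) :
    coneExp (insert w W) c x (insert w S) = (1 + x) * coneExp W c x (insert w S) -
      ∑ B ∈ S.powerset with (insert w B ∩ W).Nonempty,
        x * ((c (insert w B) : ℂ) * x ^ B.card * (1 + x) * coneExp W c x (S \ B)) := by
  rw [coneExp, coneExp, setExp_insert _ hw, setExp_insert _ hw, Finset.sum_filter,
    Finset.mul_sum, ← Finset.sum_sub_distrib]
  refine Finset.sum_congr rfl fun B hB => ?_
  have h1 : coneExp (insert w W) c x (S \ B) = coneExp W c x (S \ B) :=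
    coneExp_insert_of_notMem W fun h => hw (Finset.mem_sdiff.1 h).1
  rw [coneExp] at h1
  rw [h1, ← coneExp, touching, if_pos ⟨w, by simp⟩, touching, blockWeight,
    Finset.card_insert_of_notMem fun h => hw (Finset.mem_powerset.1 hB h), Nat.add_sub_cancel]
  split_ifs <;> ring

/-- Removing vertices from a subset of `S` decreases `F` by at most `1 - a` for each vertex. -/
def SlowlyVarying (F : Finset V → ℂ) (a : ℝ) (S : Finset V) : Prop :=
  ∀ R ⊆ S, ∀ T ⊆ R, ‖F (R \ T)‖ * (1 - a) ^ T.card ≤ ‖F R‖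

theorem SlowlyVarying.mono {F : Finset V → ℂ} {a : ℝ} {S S' : Finset V}
    (h : SlowlyVarying F a S) (hS : S' ⊆ S) : SlowlyVarying F a S' :=
  fun R hR => h R (hR.trans hS)

variable {s a Y : ℝ}

/-- The factor `1 - a` in the bound on `x` pays exactly for restoring one removed vertex. -/
theorem norm_pow_mul_le (hx : ‖x‖ ≤ (1 - a) * s) (hs : 0 ≤ s) {F : Finset V → ℂ} {S T : Finset V}
    (h : SlowlyVarying F a S) (hT : T ⊆ S) :
    ‖x‖ ^ T.card * ‖F (S \ T)‖ ≤ s ^ T.card * ‖F S‖ := by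
  calc ‖x‖ ^ T.card * ‖F (S \ T)‖ ≤ ((1 - a) * s) ^ T.card * ‖F (S \ T)‖ := by gcongr
    _ = s ^ T.card * (‖F (S \ T)‖ * (1 - a) ^ T.card) := by rw [mul_pow]; ring
    _ ≤ _ := by
      have := h S le_rfl T hT
      gcongr

theorem norm_coneExp_le (hc0 : ∀ B : Finset V, B.Nonempty → 0 ≤ c B)
    (hx : ‖x‖ ≤ (1 - a) * s) (hs : 0 ≤ s) {S : Finset V}
    (h : SlowlyVarying (setExp (blockWeight c x)) a S) (W : Finset V) :
    ‖coneExp W c x S‖ ≤ attachSum W c s S * ‖setExp (blockWeight c x) S‖ := by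
  rw [coneExp_eq_sum, attachSum, Finset.sum_mul]
  refine (norm_sum_le _ _).trans (Finset.sum_le_sum fun R hR => ?_)
  have h0 : 0 ≤ setExp (touching W c) R :=
    setExp_nonneg fun _ _ hB => touching_nonneg hc0 W hB
  rw [norm_mul, norm_mul, norm_pow, Complex.norm_real, Real.norm_of_nonneg h0, mul_assoc,
    mul_assoc]
  exact mul_le_mul_of_nonneg_left (norm_pow_mul_le hx hs h (Finset.mem_powerset.1 hR)) h0

/-- Add the vertices of `W` one at a time. Each contributes a factor `1 + x`, up to blocks joining
it to an earlier vertex; there are `|W| choose 2` pairs, each weighing at most `P`. Such a block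
uses up a vertex of `W`, which saves one factor `1 + s Y`, and this pays for `‖1 + x‖`. -/
theorem norm_coneExp_sub_le (hc0 : ∀ B : Finset V, B.Nonempty → 0 ≤ c B)
    (ha : 0 ≤ a) (hx : ‖x‖ ≤ (1 - a) * s) (hs : 0 ≤ s) (hY1 : 1 ≤ Y) {P : ℝ}
    {S : Finset V} (h : SlowlyVarying (setExp (blockWeight c x)) a S) (W : Finset V)
    (hWS : W ⊆ S) (hWY : ∀ w ∈ W, pairSum c s S w w ≤ Y)
    (hWP : ∀ v ∈ W, ∀ w ∈ W, v ≠ w → pairSum c s S v w ≤ P) :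
    ‖coneExp W c x S - (1 + x) ^ W.card * setExp (blockWeight c x) S‖ ≤
      W.card.choose 2 * (s * P * (1 + s * Y) ^ (W.card - 1)) * ‖setExp (blockWeight c x) S‖ := by
  set F := setExp (blockWeight c x) with hF
  have hxs : ‖x‖ ≤ s := hx.trans (by nlinarith)
  have hsY : 0 ≤ s * Y := mul_nonneg hs (by linarith)
  have hx1 : ‖1 + x‖ ≤ 1 + s * Y := by
    refine (norm_add_le _ _).trans ?_
    rw [norm_one]
    nlinarith
  induction W using Finset.induction_on with
  | empty => simp [coneExp_empty, hF]
  | insert w W hw ih =>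
  have ih := ih ((Finset.subset_insert w W).trans hWS)
    (fun v hv => hWY v (Finset.mem_insert_of_mem hv))
    fun u hu v hv => hWP u (Finset.mem_insert_of_mem hu) v (Finset.mem_insert_of_mem hv)
  obtain ⟨S, hwS, rfl⟩ : ∃ S', w ∉ S' ∧ S = insert w S' :=
    ⟨S.erase w, Finset.notMem_erase _ _, (Finset.insert_erase (hWS (by simp))).symm⟩
  rw [Finset.card_insert_of_notMem hw]
  set m := W.card with hm
  set E := ∑ B ∈ S.powerset with (insert w B ∩ W).Nonempty,
        x * ((c (insert w B) : ℂ) * x ^ B.card * (1 + x) * coneExp W c x (S \ B)) with hE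
  have hpair : ∀ v, pairSum c s (insert w S) v w =
      ∑ B ∈ S.powerset, if v ∈ insert w B then c (insert w B) * s ^ B.card else 0 := by
    intro v
    rw [pairSum, sum_powerset_filter_insert hwS _ _ fun B h => h.2, Finset.sum_filter]
    refine Finset.sum_congr rfl fun C hC => ?_
    rw [Finset.card_insert_of_notMem fun h => hwS (Finset.mem_powerset.1 hC h),
      Nat.add_sub_cancel]
    simp
  have hEle : ‖E‖ ≤ m * (s * P * (1 + s * Y) ^ m) * ‖F (insert w S)‖ := by
    calc ‖E‖ ≤ ∑ B ∈ S.powerset, (s * (1 + s * Y) ^ m * ‖F (insert w S)‖) *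
          ∑ v ∈ W, if v ∈ insert w B then c (insert w B) * s ^ B.card else 0 := by
          rw [hE, Finset.sum_filter]
          refine (norm_sum_le _ _).trans (Finset.sum_le_sum fun B hB => ?_)
          rw [Finset.mem_powerset] at hB
          have hcB := hc0 _ (Finset.insert_nonempty w B)
          have hnn : ∀ v ∈ W,
              0 ≤ if v ∈ insert w B then c (insert w B) * s ^ B.card else 0 := by
            intro z _
            split_ifs
            exacts [by positivity, le_rfl]
          split_ifs with hBW
          · obtain ⟨v, hv⟩ := hBW
            rw [Finset.mem_inter] at hv
            have h1 := Finset.single_le_sum hnn hv.2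
            rw [if_pos hv.1] at h1
            refine le_trans ?_ (mul_le_mul_of_nonneg_left h1 (by positivity))
            have hsub : S \ B ⊆ insert w S :=
              Finset.sdiff_subset.trans (Finset.subset_insert _ _)
            have h2 : attachSum W c s (S \ B) ≤ (1 + s * Y) ^ (m - 1) := by
              refine (attachSum_le hc0 hs (by linarith) W fun u hu => ?_).trans
                (pow_le_pow_right₀ (by linarith) (Nat.le_sub_one_of_lt
                (Finset.card_lt_card (Finset.ssubset_iff.2
                  ⟨v, ?_, Finset.insert_subset hv.2 Finset.inter_subset_left⟩))))
              · rw [Finset.mem_inter] at hu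
                exact (pairSum_mono hc0 hs hsub u u).trans
                  (hWY u (Finset.mem_insert_of_mem hu.1))
              · intro h'
                rw [Finset.mem_inter, Finset.mem_sdiff] at h'
                rcases Finset.mem_insert.1 hv.1 with rfl | h''
                exacts [hwS h'.2.1, h'.2.2 h'']
            have h3 : ‖coneExp W c x (S \ B)‖ ≤ (1 + s * Y) ^ (m - 1) * ‖F (S \ B)‖ :=
              (norm_coneExp_le hc0 hx hs (h.mono hsub) W).trans
                (mul_le_mul_of_nonneg_right h2 (norm_nonneg _))
            have h4 := norm_pow_mul_le hx hs h (Finset.insert_subset_insert w hB)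
            rw [Finset.card_insert_of_notMem fun h => hwS (hB h),
              Finset.insert_sdiff_insert, Finset.sdiff_insert_of_notMem hwS] at h4
            have hmpos : m - 1 + 1 = m :=
              Nat.sub_add_cancel (Finset.card_pos.2 ⟨v, hv.2⟩)
            rw [norm_mul, norm_mul, norm_mul, norm_mul, norm_pow, Complex.norm_real,
              Real.norm_of_nonneg hcB]
            calc ‖x‖ * (c (insert w B) * ‖x‖ ^ B.card * ‖1 + x‖ * ‖coneExp W c x (S \ B)‖)
                ≤ ‖x‖ * (c (insert w B) * ‖x‖ ^ B.card * (1 + s * Y) *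
                  ((1 + s * Y) ^ (m - 1) * ‖F (S \ B)‖)) := by gcongr
              _ = c (insert w B) * (1 + s * Y) ^ (m - 1 + 1) *
                  (‖x‖ ^ (B.card + 1) * ‖F (S \ B)‖) := by ring
              _ ≤ c (insert w B) * (1 + s * Y) ^ (m - 1 + 1) *
                  (s ^ (B.card + 1) * ‖F (insert w S)‖) := by gcongr
              _ = _ := by rw [hmpos]; ring
          · rw [norm_zero]
            exact mul_nonneg (by positivity) (Finset.sum_nonneg hnn)
      _ = (s * (1 + s * Y) ^ m * ‖F (insert w S)‖) * ∑ v ∈ W, pairSum c s (insert w S) v w := by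
          rw [← Finset.mul_sum, Finset.sum_comm]
          simp only [hpair]
      _ ≤ (s * (1 + s * Y) ^ m * ‖F (insert w S)‖) * (m * P) := by
          refine mul_le_mul_of_nonneg_left ?_ (by positivity)
          rw [hm, ← nsmul_eq_mul]
          refine Finset.sum_le_card_nsmul _ _ _ fun v hv => ?_
          exact hWP v (Finset.mem_insert_of_mem hv) w (by simp) fun h => hw (h ▸ hv)
      _ = _ := by ring
  have hmain : coneExp (insert w W) c x (insert w S) - (1 + x) ^ (m + 1) * F (insert w S) =
      (1 + x) * (coneExp W c x (insert w S) - (1 + x) ^ m * F (insert w S)) - E := by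
    rw [coneExp_insert W hwS]
    ring
  -- Pascal's rule: the new vertex forms `m` new pairs.
  have hchoose : ((m + 1).choose 2 : ℝ) = m + m.choose 2 := by
    rw [Nat.choose_succ_succ' m 1]
    simp
  rw [hmain, hchoose, Nat.add_sub_cancel]
  refine (norm_sub_le _ _).trans ?_
  rw [norm_mul, add_mul, add_mul, add_comm]
  refine add_le_add hEle ?_
  calc _ ≤ (1 + s * Y) * (m.choose 2 * (s * P * (1 + s * Y) ^ (m - 1)) * ‖F (insert w S)‖) := by
        gcongr
    _ = _ := by
        rcases Nat.eq_zero_or_pos m with h0 | h0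
        · simp [h0]
        · obtain ⟨k, hk⟩ := Nat.exists_eq_add_of_le' h0
          rw [hk, Nat.add_sub_cancel, pow_succ]
          ring

theorem norm_one_add_pow_sub_one_le (x : ℂ) (n : ℕ) : ‖(1 + x) ^ n - 1‖ ≤ (1 + ‖x‖) ^ n - 1 := by
  induction n with
  | zero => simp
  | succ n ih =>
    calc ‖(1 + x) ^ (n + 1) - 1‖ = ‖((1 + x) ^ n - 1) * (1 + x) + x‖ := by ring_nf
      _ ≤ ((1 + ‖x‖) ^ n - 1) * (1 + ‖x‖) + ‖x‖ := by
        refine (norm_add_le _ _).trans ?_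
        rw [norm_mul]
        have : ‖1 + x‖ ≤ 1 + ‖x‖ := (norm_add_le _ _).trans (by rw [norm_one])
        gcongr
        exact (norm_nonneg _).trans ih
      _ = _ := by ring

theorem slowlyVarying_of_forall_insert {F : Finset V → ℂ} {a : ℝ} (ha : a ≤ 1) {S : Finset V}
    (h : ∀ R ⊂ S, ∀ u ∈ S, u ∉ R → ‖F (insert u R) - F R‖ ≤ a * ‖F R‖) :
    SlowlyVarying F a S := by
  intro R hR T hT
  induction T using Finset.induction_on with
  | empty => simp
  | insert v T hv ih =>
    have ih := ih ((Finset.subset_insert v T).trans hT)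
    have hvR : v ∈ R := hT (by simp)
    have hins : insert v (R \ insert v T) = R \ T := by
      rw [Finset.sdiff_insert, Finset.insert_erase]
      simp [hvR, hv]
    have hss : R \ insert v T ⊂ S := by
      refine (Finset.ssubset_iff.2 ⟨v, by simp, ?_⟩ : R \ insert v T ⊂ R).trans_subset hR
      exact Finset.insert_subset hvR Finset.sdiff_subset
    have h1 := h _ hss v (hR hvR) (by simp)
    rw [hins] at h1
    have h2 := norm_sub_norm_le (F (R \ insert v T)) (F (R \ T))
    rw [norm_sub_rev] at h2
    rw [Finset.card_insert_of_notMem hv, pow_succ]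
    have h3 : ‖F (R \ insert v T)‖ * (1 - a) ≤ ‖F (R \ T)‖ := by linarith
    have h4 : 0 ≤ (1 - a) ^ T.card := pow_nonneg (by linarith) _
    nlinarith

variable [Fintype V] (G : SimpleGraph V) [DecidableRel G.Adj]

/-- By the recursion for `c`, removing `u` from its block leaves blocks meeting the neighbours of
`u`, which is the expansion `coneExp_eq_sum`. -/
theorem setExp_blockWeight_insert
    (hc : ∀ v S, v ∉ S → c (insert v S) = setExp (touching (G.neighborFinset v) c) S)
    {u : V} {S : Finset V} (hu : u ∉ S) :
    setExp (blockWeight c x) (insert u S) = coneExp (G.neighborFinset u ∩ S) c x S := by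
  have : coneExp (G.neighborFinset u ∩ S) c x S = coneExp (G.neighborFinset u) c x S := by
    refine setExp_congr fun B hB _ => ?_
    rw [touching, touching, Finset.inter_comm _ S, ← Finset.inter_assoc,
      Finset.inter_eq_left.2 hB]
  rw [this, coneExp_eq_sum, setExp_insert _ hu]
  refine Finset.sum_congr rfl fun T hT => ?_
  have huT : u ∉ T := fun h => hu (Finset.mem_powerset.1 hT h)
  rw [blockWeight, hc u T huT, Finset.card_insert_of_notMem huT, Nat.add_sub_cancel]

/-- The hypothesis `hK` makes the induction close: its first term bounds `(1 + x)^m - 1`, its second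
the correlation error between neighbours of `u`. The estimate on proper subsets of `S` supplies the
slow variation needed on `S`. -/
theorem norm_setExp_insert_sub_le (hc0 : ∀ B : Finset V, B.Nonempty → 0 ≤ c B)
    (hc : ∀ v S, v ∉ S → c (insert v S) = setExp (touching (G.neighborFinset v) c) S)
    (ha : 0 ≤ a) (ha1 : a ≤ 1) (hx : ‖x‖ ≤ (1 - a) * s) (hs : 0 ≤ s) (hY1 : 1 ≤ Y)
    {D : ℕ} (hD : ∀ v, G.degree v ≤ D + 1) (hY : (1 + s * Y) ^ D ≤ Y) {p : ℝ}
    (hp : p = s * (1 + s * Y) ^ (D - 1)) (hDp : D * p < 1) {e : ℕ}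
    (hfar : ∀ (S : Finset V) (u v w : V), u ∉ S → G.Adj u v → G.Adj u w → v ≠ w →
      Far G S v w (e + 1))
    (hK : (1 + (1 - a) * s) ^ (D + 1) - 1 + (D + 1).choose 2 *
      (s * (Y * p * (D * p) ^ e / (1 - D * p)) * (1 + s * Y) ^ D) ≤ a)
    (S : Finset V) {u : V} (hu : u ∉ S) :
    ‖setExp (blockWeight c x) (insert u S) - setExp (blockWeight c x) S‖ ≤
      a * ‖setExp (blockWeight c x) S‖ := by
  have hY0 : 0 ≤ Y := by linarith
  have hp0 : 0 ≤ p := by rw [hp]; positivity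
  have h1 : 0 < 1 - D * p := by linarith
  induction S using Finset.strongInduction generalizing u with
  | H S ih =>
  have hslow : SlowlyVarying (setExp (blockWeight c x)) a S :=
    slowlyVarying_of_forall_insert ha1 fun R hR v _ hv => ih R hR hv
  set F := setExp (blockWeight c x) with hF
  set P := Y * p * (D * p) ^ e / (1 - D * p) with hP
  have hP0 : 0 ≤ P := by positivity
  set W := G.neighborFinset u ∩ S with hW
  have hdeg : ∀ v ∈ W, (G.neighborFinset v ∩ S).card ≤ D := by
    intro v hv
    rw [hW, Finset.mem_inter, SimpleGraph.mem_neighborFinset] at hv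
    refine Nat.lt_succ_iff.1 (lt_of_lt_of_le (Finset.card_lt_card ?_) (hD v))
    rw [Finset.ssubset_iff]
    refine ⟨u, by simp [hu], Finset.insert_subset ?_ Finset.inter_subset_left⟩
    simpa using hv.1.symm
  have hWS : W ⊆ S := Finset.inter_subset_right
  have hadj : ∀ v ∈ W, G.Adj u v := fun v hv => by
    simpa using (Finset.mem_inter.1 hv).1
  have hmain := norm_coneExp_sub_le hc0 ha hx hs hY1 hslow W hWS
    (fun w hw => (pairSum_self_le G hc0 hc hs hY0 hD hY (hWS hw)).trans
      ((pow_le_pow_right₀ (le_add_of_nonneg_right (by positivity)) (hdeg w hw)).trans hY))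
    fun v hv w hw hvw => pairSum_le_of_far G hc0 hc hs hY0 hD hY hp hDp (hWS hv) (hWS hw) hvw
      (hdeg v hv) (hdeg w hw) (hfar S u v w hu (hadj v hv) (hadj w hw) hvw)
  rw [← setExp_blockWeight_insert G hc hu] at hmain
  have hcard : W.card ≤ D + 1 :=
    (Finset.card_le_card Finset.inter_subset_left).trans (hD u)
  have h2 : (W.card.choose 2 : ℝ) * (s * P * (1 + s * Y) ^ (W.card - 1)) ≤
      (D + 1).choose 2 * (s * P * (1 + s * Y) ^ D) := by
    have h3 : ((W.card.choose 2 : ℕ) : ℝ) ≤ ((D + 1).choose 2 : ℕ) :=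
      Nat.cast_le.2 (Nat.choose_le_choose 2 hcard)
    have h4 : (1 + s * Y) ^ (W.card - 1) ≤ (1 + s * Y) ^ D :=
      pow_le_pow_right₀ (le_add_of_nonneg_right (by positivity)) (by omega)
    gcongr
  have h5 : ‖(1 + x) ^ W.card - 1‖ ≤ (1 + (1 - a) * s) ^ (D + 1) - 1 := by
    refine (norm_one_add_pow_sub_one_le x _).trans (sub_le_sub_right ?_ 1)
    calc (1 + ‖x‖) ^ W.card ≤ (1 + ‖x‖) ^ (D + 1) :=
          pow_le_pow_right₀ (le_add_of_nonneg_right (norm_nonneg x)) hcard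
      _ ≤ _ := by gcongr
  calc ‖F (insert u S) - F S‖
      = ‖(F (insert u S) - (1 + x) ^ W.card * F S) + ((1 + x) ^ W.card - 1) * F S‖ := by
        ring_nf
    _ ≤ (D + 1).choose 2 * (s * P * (1 + s * Y) ^ D) * ‖F S‖ +
        ((1 + (1 - a) * s) ^ (D + 1) - 1) * ‖F S‖ := by
        refine (norm_add_le _ _).trans (add_le_add (hmain.trans ?_) ?_)
        · exact mul_le_mul_of_nonneg_right h2 (norm_nonneg _)
        · rw [norm_mul]
          exact mul_le_mul_of_nonneg_right h5 (norm_nonneg _)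
    _ = (((1 + (1 - a) * s) ^ (D + 1) - 1) + (D + 1).choose 2 * (s * P * (1 + s * Y) ^ D)) *
        ‖F S‖ := by ring
    _ ≤ a * ‖F S‖ := mul_le_mul_of_nonneg_right hK (norm_nonneg _)

theorem aeval_chromaticPolynomial_ne_zero {q : ℂ} (hq : q ≠ 0)
    (ha : 0 ≤ a) (ha1 : a < 1) (hqs : ‖q‖⁻¹ ≤ (1 - a) * s) (hs : 0 ≤ s) (hY1 : 1 ≤ Y)
    {D : ℕ} (hD : ∀ v, G.degree v ≤ D + 1) (hY : (1 + s * Y) ^ D ≤ Y) {p : ℝ}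
    (hp : p = s * (1 + s * Y) ^ (D - 1)) (hDp : D * p < 1) {e : ℕ}
    (hg : ((e + 3 : ℕ) : ℕ∞) ≤ G.egirth)
    (hK : (1 + (1 - a) * s) ^ (D + 1) - 1 + (D + 1).choose 2 *
      (s * (Y * p * (D * p) ^ e / (1 - D * p)) * (1 + s * Y) ^ D) ≤ a) :
    aeval q (ChromaticZeros.chromaticPolynomial G) ≠ 0 := by
  set c : Finset V → ℝ := fun B => (conn G B : ℝ) with hcdef
  have hc0 : ∀ B : Finset V, B.Nonempty → 0 ≤ c B := fun B hB =>
    Int.cast_nonneg (conn_nonneg G B hB)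
  have hc : ∀ v S, v ∉ S → c (insert v S) = setExp (touching (G.neighborFinset v) c) S := by
    intro v S hv
    have h := map_setExp (Int.castRingHom ℝ) (touching (G.neighborFinset v) (conn G)) S
    rw [← conn_insert G hv] at h
    refine Eq.trans h (setExp_congr fun B _ _ => ?_)
    rw [touching, touching]
    split_ifs <;> simp [hcdef]
  have hx : ‖-q⁻¹‖ ≤ (1 - a) * s := by rwa [norm_neg, norm_inv]
  have hstep := fun S u hu => norm_setExp_insert_sub_le (u := u) G hc0 hc ha ha1.le hx hs hY1 hD
    hY hp hDp (far_of_le_egirth G hg) hK S hu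
  have hne : ∀ S : Finset V, setExp (blockWeight c (-q⁻¹)) S ≠ 0 := by
    intro S
    induction S using Finset.induction_on with
    | empty => simp
    | insert u S hu ih =>
      intro h
      have := hstep S u hu
      rw [h, zero_sub, norm_neg] at this
      have h1 := norm_pos_iff.2 ih
      nlinarith
  rw [aeval_chromaticPolynomial]
  -- The sign `(-1)^(|B|-1)` relating `conn` to `connWeight` is that of `(-1/q)^(|B|-1)`.
  have hw : setExp (fun B => q * (connWeight G B : ℂ)) Finset.univ =
      setExp (fun B => q ^ B.card * blockWeight c (-q⁻¹) B) Finset.univ := by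
    refine setExp_congr fun B _ hB => ?_
    obtain ⟨k, hk⟩ := Nat.exists_eq_add_of_le' (Finset.card_pos.2 hB)
    simp only [blockWeight, hcdef, conn, hk, Nat.add_sub_cancel]
    push_cast
    have h1 : q ^ k * (q⁻¹) ^ k = 1 := by rw [← mul_pow, mul_inv_cancel₀ hq, one_pow]
    have h2 : (-1 : ℂ) ^ k * (-1) ^ k = 1 := by rw [← mul_pow]; simp
    rw [neg_pow q⁻¹ k]
    calc q * (connWeight G B : ℂ)
        = q * (connWeight G B : ℂ) * (q ^ k * (q⁻¹) ^ k) * ((-1 : ℂ) ^ k * (-1) ^ k) := by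
          rw [h1, h2, mul_one, mul_one]
      _ = _ := by ring
  rw [hw, setExp_pow_card_mul]
  exact mul_ne_zero (pow_ne_zero _ hq) (hne _)

end Main

end SubsetExp

/-! ### The functions `x`, `f`, `K` in the variable `t = b^(1/Δ)`, and their monotonicity. -/

namespace ChromaticZeros

/-- `x_Δ(t ^ Δ)` for `Δ = n + 3`. -/
noncomputable def rootX (n : ℕ) (t : ℝ) : ℝ := (t ^ 2 - t) / t ^ (n + 3)

/-- `(Δ - 1) (1 - b ^ (-1/Δ))` for `Δ = n + 3` and `b = t ^ Δ`. -/
noncomputable def branch (n : ℕ) (t : ℝ) : ℝ := (n + 2) * (1 - t⁻¹)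

/-- `K_Δ^g(a, t ^ Δ)` for `Δ = n + 3` and `g = e + 3`. -/
noncomputable def rootK (n e : ℕ) (a t : ℝ) : ℝ :=
  (1 + (1 - a) * rootX n t) ^ (n + 3) - 1 +
    1 / ((n : ℝ) + 2) * (branch n t ^ (e + 1) / (1 - branch n t)) * ((n + 3).choose 2 : ℝ) *
      (t ^ 2 - t) * (1 + (t ^ 2 - t)) ^ (n + 2)

/-- The `Δ`-th root of `ρ_Δ` for `Δ = n + 3`. -/
noncomputable def tau (n : ℕ) : ℝ := ((n : ℝ) + 2) / ((n : ℝ) + 1)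

variable {n e : ℕ} {a t : ℝ}

theorem rho_eq (n : ℕ) : rho (n + 3) = tau n ^ (n + 3) := by
  rw [rho, tau]
  push_cast
  congr 2 <;> ring

theorem one_lt_tau (n : ℕ) : 1 < tau n := by
  rw [tau, one_lt_div (by positivity)]
  linarith

theorem x_pow (ht : 0 < t) : x (n + 3) (t ^ (n + 3)) = rootX n t := by
  have h0 : ((n + 3 : ℕ) : ℝ) ≠ 0 := by positivity
  rw [x, rootX, ← Real.rpow_natCast t (n + 3), ← Real.rpow_mul ht.le, ← Real.rpow_mul ht.le,
    mul_div_cancel₀ _ h0, mul_one_div_cancel h0, Real.rpow_one, Real.rpow_two]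

theorem K_pow (ht : 0 < t) : K (n + 3) (e + 3) a (t ^ (n + 3)) = rootK n e a t := by
  have h0 : ((n + 3 : ℕ) : ℝ) ≠ 0 := by positivity
  have h1 : (t ^ (n + 3)) ^ (-(1 / ((n + 3 : ℕ) : ℝ))) = t⁻¹ := by
    rw [← Real.rpow_natCast t (n + 3), ← Real.rpow_mul ht.le, mul_neg, mul_one_div_cancel h0,
      Real.rpow_neg_one]
  have h2 : t ^ (n + 3) * rootX n t = t ^ 2 - t := by
    rw [rootX, mul_div_cancel₀ _ (by positivity)]
  have h3 : ((n + 3 : ℕ) : ℝ) - 1 = n + 2 := by push_cast; ring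
  rw [K, rootK, x_pow ht, h2, f, h1, h3, branch]
  rfl

theorem exists_root {b : ℝ} (hb : b ∈ Ico 1 (rho (n + 3))) :
    ∃ t ∈ Ico 1 (tau n), t ^ (n + 3) = b := by
  have hb0 : 0 ≤ b := by linarith [hb.1]
  have ht0 : 0 ≤ b ^ (((n + 3 : ℕ) : ℝ)⁻¹) := Real.rpow_nonneg hb0 _
  have ht : (b ^ (((n + 3 : ℕ) : ℝ)⁻¹)) ^ (n + 3) = b :=
    Real.rpow_inv_natCast_pow hb0 (by omega)
  refine ⟨_, ⟨?_, ?_⟩, ht⟩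
  · exact Real.one_le_rpow hb.1 (by positivity)
  · refine lt_of_pow_lt_pow_left₀ (n + 3) (by linarith [one_lt_tau n]) ?_
    rw [ht, ← rho_eq]
    exact hb.2

theorem pow_mem_Ico (ht : t ∈ Ico 1 (tau n)) : t ^ (n + 3) ∈ Ico 1 (rho (n + 3)) := by
  refine ⟨one_le_pow₀ ht.1, ?_⟩
  rw [rho_eq]
  exact pow_lt_pow_left₀ ht.2 (by linarith [ht.1]) (by omega)

theorem branch_nonneg (ht : 1 ≤ t) : 0 ≤ branch n t :=
  mul_nonneg (by positivity) (sub_nonneg.2 (inv_le_one_of_one_le₀ ht))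

theorem branch_lt_one (ht : t ∈ Ico 1 (tau n)) : branch n t < 1 := by
  have h0 : 0 < t := by linarith [ht.1]
  have h1 := ht.2
  rw [tau, lt_div_iff₀ (by positivity)] at h1
  have h2 : branch n t = (n + 2) * (t - 1) / t := by
    rw [branch]
    field_simp
  rw [h2, div_lt_one h0]
  linarith

theorem branch_strictMono {t₁ t₂ : ℝ} (h1 : 1 ≤ t₁) (h : t₁ < t₂) : branch n t₁ < branch n t₂ := by
  have : t₂⁻¹ < t₁⁻¹ := inv_strictAnti₀ (by linarith) h
  rw [branch, branch]
  gcongr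

theorem rootX_eq (ht : 0 < t) : rootX n t = (t⁻¹) ^ (n + 1) - (t⁻¹) ^ (n + 2) := by
  have h1 : t⁻¹ ^ (n + 1) = t ^ 2 / t ^ (n + 3) := by
    rw [inv_pow, inv_eq_one_div, div_eq_div_iff (by positivity) (by positivity)]
    ring
  have h2 : t⁻¹ ^ (n + 2) = t / t ^ (n + 3) := by
    rw [inv_pow, inv_eq_one_div, div_eq_div_iff (by positivity) (by positivity)]
    ring
  rw [rootX, h1, h2, sub_div]

/-- With `w = 1/t` this function is `rootX`; its critical point `(n + 1)/(n + 2)` is exactly `1 /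
tau n`, so `x_Δ` increases up to `ρ_Δ`. -/
theorem antitoneOn_pow_sub_pow (n : ℕ) :
    AntitoneOn (fun w : ℝ => w ^ (n + 1) - w ^ (n + 2)) (Ici (((n : ℝ) + 1) / (n + 2))) := by
  refine antitoneOn_of_deriv_nonpos (convex_Ici _) (by fun_prop) (by fun_prop) fun w hw => ?_
  rw [interior_Ici, mem_Ioi, div_lt_iff₀ (by positivity)] at hw
  have hd : HasDerivAt (fun w : ℝ => w ^ (n + 1) - w ^ (n + 2))
      (((n + 1 : ℕ) : ℝ) * w ^ n - ((n + 2 : ℕ) : ℝ) * w ^ (n + 1)) w :=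
    (hasDerivAt_pow (n + 1) w).sub (hasDerivAt_pow (n + 2) w)
  rw [hd.deriv]
  have hw0 : 0 ≤ w := by
    by_contra h
    have : (n : ℝ) + 1 < 0 := hw.trans (mul_neg_of_neg_of_pos (not_le.1 h) (by positivity))
    linarith [(Nat.cast_nonneg n : (0 : ℝ) ≤ n)]
  have : ((n + 1 : ℕ) : ℝ) * w ^ n - ((n + 2 : ℕ) : ℝ) * w ^ (n + 1) =
      w ^ n * ((n : ℝ) + 1 - w * (n + 2)) := by push_cast; ring
  rw [this]
  exact mul_nonpos_of_nonneg_of_nonpos (pow_nonneg hw0 n) (by linarith)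

theorem rootX_mono {t₁ t₂ : ℝ} (h1 : 1 ≤ t₁) (h : t₁ ≤ t₂) (h2 : t₂ < tau n) :
    rootX n t₁ ≤ rootX n t₂ := by
  have ht₂ : ((n : ℝ) + 1) / (n + 2) ≤ t₂⁻¹ := by
    rw [← inv_div]
    exact inv_anti₀ (by linarith) h2.le
  have ht : t₂⁻¹ ≤ t₁⁻¹ := inv_anti₀ (by linarith) h
  rw [rootX_eq (by linarith), rootX_eq (by linarith)]
  exact antitoneOn_pow_sub_pow n ht₂ (ht₂.trans ht) ht

theorem rootX_nonneg (ht : 1 ≤ t) : 0 ≤ rootX n t :=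
  div_nonneg (by nlinarith) (by positivity)

/-- Every factor is nonnegative and nondecreasing; strictness comes from `t ^ 2 - t`, whose cofactor
is positive at `t₂`. -/
theorem rootK_strictMonoOn (n e : ℕ) (ha : a ≤ 1) :
    StrictMonoOn (rootK n e a) (Ico 1 (tau n)) := by
  intro t₁ h₁ t₂ h₂ h
  have hX := rootX_mono h₁.1 h.le h₂.2
  have hX0 := rootX_nonneg (n := n) h₁.1
  have hb := branch_strictMono (n := n) h₁.1 h
  have hb0 := branch_nonneg (n := n) h₁.1
  have hb1 := branch_lt_one h₂
  have hu0 : 0 ≤ t₁ ^ 2 - t₁ := by nlinarith [h₁.1]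
  have hu : t₁ ^ 2 - t₁ < t₂ ^ 2 - t₂ := by nlinarith [h₁.1]
  have hc : (0 : ℝ) < ((n + 3).choose 2 : ℝ) := Nat.cast_pos.2 (Nat.choose_pos (by omega))
  have ha' : 0 ≤ 1 - a := by linarith
  rw [rootK, rootK]
  refine add_lt_add_of_le_of_lt (by gcongr) ?_
  have hF : branch n t₁ ^ (e + 1) / (1 - branch n t₁) ≤
      branch n t₂ ^ (e + 1) / (1 - branch n t₂) := by
    have : 0 < 1 - branch n t₂ := by linarith
    have : 0 ≤ branch n t₂ := by linarith
    gcongr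
  have hF0 : 0 < branch n t₂ ^ (e + 1) / (1 - branch n t₂) :=
    div_pos (pow_pos (by linarith) _) (by linarith)
  have hv : (1 + (t₁ ^ 2 - t₁)) ^ (n + 2) ≤ (1 + (t₂ ^ 2 - t₂)) ^ (n + 2) := by gcongr
  have hv0 : 0 < (1 + (t₂ ^ 2 - t₂)) ^ (n + 2) := by
    have : 0 < t₂ ^ 2 - t₂ := by linarith
    positivity
  calc _ ≤ 1 / ((n : ℝ) + 2) * (branch n t₂ ^ (e + 1) / (1 - branch n t₂)) *
        ((n + 3).choose 2 : ℝ) * (t₁ ^ 2 - t₁) * (1 + (t₂ ^ 2 - t₂)) ^ (n + 2) := by gcongr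
    _ < _ := by gcongr

theorem rootK_anti (ht : 1 ≤ t) {a₁ a₂ : ℝ} (h : a₁ ≤ a₂) (h2 : a₂ ≤ 1) :
    rootK n e a₂ t ≤ rootK n e a₁ t := by
  have hX0 := rootX_nonneg (n := n) ht
  have : 0 ≤ 1 - a₂ := by linarith
  rw [rootK, rootK]
  gcongr

theorem rootK_one (n e : ℕ) (a : ℝ) : rootK n e a 1 = 0 := by
  simp [rootK, rootX]

theorem continuousOn_rootX (n : ℕ) : ContinuousOn (rootX n) (Ici 1) := by
  refine ContinuousOn.div (by fun_prop) (by fun_prop) fun t ht => pow_ne_zero _ ?_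
  exact (zero_lt_one.trans_le ht).ne'

theorem continuousOn_branch (n : ℕ) : ContinuousOn (branch n) (Ici 1) := by
  refine continuousOn_const.mul (continuousOn_const.sub (continuousOn_id.inv₀ fun t ht => ?_))
  exact (zero_lt_one.trans_le ht).ne'

theorem continuousOn_rootK (n e : ℕ) :
    ContinuousOn (fun p : ℝ × ℝ => rootK n e p.1 p.2) (univ ×ˢ Ico 1 (tau n)) := by
  have hmaps : MapsTo Prod.snd ((univ : Set ℝ) ×ˢ Ico 1 (tau n)) (Ici 1) := fun p hp => hp.2.1
  have hX : ContinuousOn (fun p : ℝ × ℝ => rootX n p.2) (univ ×ˢ Ico 1 (tau n)) :=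
    (continuousOn_rootX n).comp continuousOn_snd hmaps
  have hb : ContinuousOn (fun p : ℝ × ℝ => branch n p.2) (univ ×ˢ Ico 1 (tau n)) :=
    (continuousOn_branch n).comp continuousOn_snd hmaps
  have hq : ContinuousOn (fun p : ℝ × ℝ => branch n p.2 ^ (e + 1) / (1 - branch n p.2))
      (univ ×ˢ Ico 1 (tau n)) :=
    (hb.pow _).div (continuousOn_const.sub hb) fun p hp => by
      have := branch_lt_one hp.2
      exact sub_ne_zero.2 this.ne'
  unfold rootK
  fun_prop

/-! ### The solution `b_Δ^g(a)` and the maximum of `z_Δ^g`. -/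

theorem exists_one_le_rootK (n e : ℕ) : ∃ t ∈ Ico 1 (tau n), 1 ≤ rootK n e 1 t := by
  -- Take `t` where `branch` equals `1 - ε`. Bernoulli gives `(1 - ε)^(e + 2) ≥ 1/2`, the extra
  -- power coming from `t ^ 2 - t`, while the pole contributes `1/ε = 2 (e + 3)`, so the value is at
  -- least `(e + 3)/2`.
  obtain ⟨ε, hε⟩ : ∃ ε : ℝ, ε = 1 / (2 * (e + 3)) := ⟨_, rfl⟩
  have he : (0 : ℝ) ≤ e := Nat.cast_nonneg e
  have hn : (0 : ℝ) ≤ n := Nat.cast_nonneg n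
  have hε0 : 0 < ε := by rw [hε]; positivity
  have hε1 : ε * (2 * (e + 3)) = 1 := by rw [hε]; field_simp
  have hεle : ε ≤ 1 / 6 := by nlinarith
  obtain ⟨y, hy⟩ : ∃ y : ℝ, y = 1 - ε := ⟨_, rfl⟩
  have hy0 : 0 < y := by linarith
  have hden : 0 < (n : ℝ) + 2 - y := by linarith
  obtain ⟨t, ht⟩ : ∃ t : ℝ, t = ((n : ℝ) + 2) / (n + 2 - y) := ⟨_, rfl⟩
  have ht1 : 1 ≤ t := by
    rw [ht, one_le_div hden]
    linarith
  have hbr : branch n t = y := by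
    rw [branch, ht, inv_div]
    field_simp
    ring
  have hmem : t ∈ Ico 1 (tau n) := by
    refine ⟨ht1, ?_⟩
    rw [ht, tau]
    exact div_lt_div_of_pos_left (by positivity) (by positivity) (by linarith)
  refine ⟨t, hmem, ?_⟩
  have hu : y / (n + 2) ≤ t ^ 2 - t := by
    have h1 : y / (n + 2) ≤ t - 1 := by
      have h2 : t - 1 = y / (n + 2 - y) := by
        rw [ht]
        field_simp
        ring
      rw [h2]
      exact div_le_div_of_nonneg_left hy0.le hden (by linarith)
    nlinarith
  have hu0 : 0 ≤ t ^ 2 - t := le_trans (by positivity) hu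
  have hv : 1 ≤ (1 + (t ^ 2 - t)) ^ (n + 2) := one_le_pow₀ (by linarith)
  have hc : ((n + 3).choose 2 : ℝ) = (n + 3) * (n + 2) / 2 := by
    rw [Nat.cast_choose_two]
    push_cast
    ring
  have hpow : 1 / 2 ≤ y ^ (e + 2) := by
    have := one_add_mul_le_pow (a := -ε) (by linarith) (e + 2)
    rw [hy, sub_eq_add_neg]
    refine le_trans ?_ this
    push_cast
    nlinarith
  rw [rootK, hbr, hc, sub_self, zero_mul, add_zero, one_pow, sub_self, zero_add]
  have h1y : 1 - y = ε := by linarith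
  rw [h1y]
  calc (1 : ℝ) ≤ 1 / 2 * (1 / 2 * (2 * (e + 3))) := by linarith
    _ = 1 / 2 * (1 / 2 / ε) := by
        rw [hε]
        field_simp
    _ ≤ 1 / 2 * (y ^ (e + 2) / ε) := by gcongr
    _ ≤ (n + 3) / (n + 2) / 2 * (y ^ (e + 2) / ε) := by
        have : (1 : ℝ) ≤ (n + 3) / (n + 2) := by
          rw [one_le_div (by positivity)]
          linarith
        gcongr
    _ = 1 / ((n : ℝ) + 2) * (y ^ (e + 1) / ε) * ((n + 3) * (n + 2) / 2) * (y / (n + 2)) * 1 := by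
        field_simp
        ring
    _ ≤ _ := by gcongr

theorem exists_rootK_eq (n e : ℕ) (ha : a ∈ Icc (0 : ℝ) 1) :
    ∃ t ∈ Ico 1 (tau n), rootK n e a t = a := by
  obtain ⟨t₁, ht₁, h₁⟩ := exists_one_le_rootK n e
  have hsub : Icc 1 t₁ ⊆ Ico 1 (tau n) := fun t ht => ⟨ht.1, ht.2.trans_lt ht₁.2⟩
  have hcont : ContinuousOn (rootK n e a) (Icc 1 t₁) :=
    (continuousOn_rootK n e).comp (f := fun t => (a, t)) (by fun_prop)
      fun t ht => ⟨mem_univ _, hsub ht⟩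
  have hmem : a ∈ Icc (rootK n e a 1) (rootK n e a t₁) := by
    rw [rootK_one]
    exact ⟨ha.1, ha.2.trans (h₁.trans (rootK_anti ht₁.1 ha.2 le_rfl))⟩
  obtain ⟨t, ht, h⟩ := intermediate_value_Icc ht₁.1 hcont hmem
  exact ⟨t, hsub ht, h⟩

/-- By strict monotonicity the solution is the greatest element of the sublevel set. -/
theorem bsup_eq (ha : a ≤ 1) (ht : t ∈ Ico 1 (tau n)) (h : rootK n e a t = a) :
    bsup (n + 3) (e + 3) a = t ^ (n + 3) := by
  have h0 : 0 < t := by linarith [ht.1]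
  refine IsGreatest.csSup_eq ⟨⟨pow_mem_Ico ht, ?_⟩, ?_⟩
  · rw [K_pow h0, h]
  · rintro b ⟨hb, hK⟩
    obtain ⟨u, hu, rfl⟩ := exists_root hb
    have hu0 : 0 < u := by linarith [hu.1]
    rw [K_pow hu0] at hK
    refine pow_le_pow_left₀ hu0.le ?_ _
    exact ((rootK_strictMonoOn n e ha).le_iff_le hu ht).1 (hK.trans h.ge)

theorem z_eq (ha : a ≤ 1) (ht : t ∈ Ico 1 (tau n)) (h : rootK n e a t = a) :
    z (n + 3) (e + 3) a = (1 - a) * rootX n t := by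
  rw [z, bsup_eq ha ht h, x_pow (by linarith [ht.1])]

theorem mem_and_K_eq_iff (ha : a ∈ Icc (0 : ℝ) 1) (b : ℝ) :
    (b ∈ Ico 1 (rho (n + 3)) ∧ K (n + 3) (e + 3) a b = a) ↔ b = bsup (n + 3) (e + 3) a := by
  constructor
  · rintro ⟨hb, hK⟩
    obtain ⟨t, ht, rfl⟩ := exists_root hb
    rw [K_pow (by linarith [ht.1])] at hK
    exact (bsup_eq ha.2 ht hK).symm
  · rintro rfl
    obtain ⟨t, ht, h⟩ := exists_rootK_eq n e ha
    rw [bsup_eq ha.2 ht h, K_pow (by linarith [ht.1])]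
    exact ⟨pow_mem_Ico ht, h⟩

/-- Continuity of `bsup` is not needed: the solution pairs `(a, t)` form a compact set, since `t₁`
bounds all solutions `t`, and on it `z` is the continuous function `(1 - a) * rootX n t`. -/
theorem exists_isMaxOn_z (n e : ℕ) :
    ∃ a ∈ Icc (0 : ℝ) 1, IsMaxOn (z (n + 3) (e + 3)) (Icc 0 1) a := by
  obtain ⟨t₁, ht₁, h₁⟩ := exists_one_le_rootK n e
  have hsub : Icc 1 t₁ ⊆ Ico 1 (tau n) := fun t ht => ⟨ht.1, ht.2.trans_lt ht₁.2⟩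
  set B : Set (ℝ × ℝ) := Icc 0 1 ×ˢ Icc 1 t₁ with hB
  have hBc : IsCompact B := isCompact_Icc.prod isCompact_Icc
  set M : Set (ℝ × ℝ) := B ∩ (fun p => rootK n e p.1 p.2 - p.1) ⁻¹' {0} with hM
  have hcont : ContinuousOn (fun p : ℝ × ℝ => rootK n e p.1 p.2 - p.1) B :=
    ((continuousOn_rootK n e).mono fun p hp => ⟨mem_univ _, hsub hp.2⟩).sub continuousOn_fst
  have hMc : IsCompact M := hBc.of_isClosed_subset
    (hcont.preimage_isClosed_of_isClosed hBc.isClosed isClosed_singleton) inter_subset_left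
  have hmem : ∀ a ∈ Icc (0 : ℝ) 1, ∃ t, (a, t) ∈ M := by
    intro a ha
    obtain ⟨t, ht, h⟩ := exists_rootK_eq n e ha
    refine ⟨t, ⟨ha, ht.1, ?_⟩, by simp [h]⟩
    refine ((rootK_strictMonoOn n e ha.2).le_iff_le ht ht₁).1 ?_
    rw [h]
    exact ha.2.trans (h₁.trans (rootK_anti ht₁.1 ha.2 le_rfl))
  have hz : ∀ p ∈ M, z (n + 3) (e + 3) p.1 = (1 - p.1) * rootX n p.2 := fun p hp =>
    z_eq hp.1.1.2 (hsub hp.1.2) (sub_eq_zero.1 hp.2)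
  obtain ⟨t₀, h₀⟩ := hmem 0 (by simp)
  have hXc : ContinuousOn (fun p : ℝ × ℝ => (1 - p.1) * rootX n p.2) M :=
    (continuousOn_const.sub continuousOn_fst).mul
      ((continuousOn_rootX n).comp continuousOn_snd fun p hp => hp.1.2.1)
  obtain ⟨p, hp, hmax⟩ := hMc.exists_isMaxOn ⟨_, h₀⟩ hXc
  refine ⟨p.1, hp.1.1, fun a ha => ?_⟩
  obtain ⟨t, hat⟩ := hmem a ha
  have : (1 - a) * rootX n t ≤ (1 - p.1) * rootX n p.2 := hmax hat
  rwa [← hz p hp, ← hz _ hat] at this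

theorem z_half_pos (n e : ℕ) : 0 < z (n + 3) (e + 3) (1 / 2) := by
  obtain ⟨t, ht, h⟩ := exists_rootK_eq n e (a := 1 / 2) (by constructor <;> norm_num)
  rw [z_eq (by norm_num) ht h]
  have ht1 : 1 < t := by
    refine lt_of_le_of_ne ht.1 ?_
    rintro rfl
    rw [rootK_one] at h
    norm_num at h
  refine mul_pos (by norm_num) (div_pos (by nlinarith) (by positivity))

/-! ### Substitution of the parameters and the zero-free region. -/

theorem aeval_chromaticPolynomial_ne_zero_of_inv_le {V : Type*} [Fintype V] (G : SimpleGraph V)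
    [DecidableRel G.Adj] {n e : ℕ} {a t : ℝ} (hD : ∀ v, G.degree v ≤ n + 3)
    (hg : ((e + 3 : ℕ) : ℕ∞) ≤ G.egirth) (ha : a ∈ Ico (0 : ℝ) 1) (ht : t ∈ Ico 1 (tau n))
    (h : rootK n e a t = a) {q : ℂ} (hq : q ≠ 0) (hqt : ‖q‖⁻¹ ≤ (1 - a) * rootX n t) :
    aeval q (chromaticPolynomial G) ≠ 0 := by
  classical
  have ht1 := ht.1
  have ht0 : 0 < t := by linarith
  have hs : rootX n t * t ^ (n + 2) = t - 1 := by
    rw [rootX]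
    field_simp
    ring
  have hs' : 1 + rootX n t * t ^ (n + 2) = t := by linarith
  have hp : 1 - t⁻¹ = rootX n t * t ^ (n + 1) := by
    rw [rootX]
    field_simp
    ring
  have hbr : ((n + 2 : ℕ) : ℝ) * (1 - t⁻¹) = branch n t := by
    rw [branch]
    push_cast
    rfl
  have hb0 : 0 ≤ branch n t := branch_nonneg ht1
  have hb1 : branch n t < 1 := branch_lt_one ht
  -- With this `Y`, `1 + s Y = t`, so `(1 + s Y)^D ≤ Y` is an equality, and `D * p < 1` is `branch n
  -- t < 1`.
  refine SubsetExp.aeval_chromaticPolynomial_ne_zero G (a := a) (s := rootX n t)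
    (Y := t ^ (n + 2)) (D := n + 2) (p := 1 - t⁻¹) (e := e) hq ha.1 ha.2 hqt (rootX_nonneg ht1)
    (one_le_pow₀ ht1) hD ?_ ?_ ?_ hg ?_
  · rw [hs']
  · rw [hs']
    exact hp
  · rw [hbr]
    exact hb1
  · rw [hs', hbr]
    refine le_trans ?_ h.le
    rw [rootK]
    refine add_le_add le_rfl ?_
    -- There is slack: the induction needs only `t - 1` and `t` where `K` has `b x = t ^ 2 - t` and
    -- `1 + b x`.
    have h1 : t - 1 ≤ t ^ 2 - t := by nlinarith
    have h2 : t ≤ 1 + (t ^ 2 - t) := by linarith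
    have hn : (0 : ℝ) < n + 2 := by positivity
    have hw : 0 ≤ 1 / ((n : ℝ) + 2) * (branch n t ^ (e + 1) / (1 - branch n t)) :=
      mul_nonneg (by positivity) (div_nonneg (by positivity) (by linarith))
    have hpe : 1 - t⁻¹ = branch n t / (n + 2) := by
      rw [branch]
      field_simp
    calc ((n + 2 + 1).choose 2 : ℝ) * (rootX n t *
          (t ^ (n + 2) * (1 - t⁻¹) * branch n t ^ e / (1 - branch n t)) * t ^ (n + 2))
        = 1 / ((n : ℝ) + 2) * (branch n t ^ (e + 1) / (1 - branch n t)) *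
          ((n + 3).choose 2 : ℝ) * (rootX n t * t ^ (n + 2)) * t ^ (n + 2) := by
          rw [hpe]
          ring
      _ ≤ _ := by
          rw [hs]
          have : 0 ≤ t - 1 := by linarith
          have : 0 ≤ t ^ 2 - t := by linarith
          gcongr

end ChromaticZeros

theorem theorem1 {V : Type*} [Fintype V] (G : SimpleGraph V) [DecidableRel G.Adj]
    (Δ g : ℕ) (hΔ : 3 ≤ Δ) (hg : 3 ≤ g) (hmax : G.maxDegree = Δ) (hgirth : G.egirth = (g : ℕ∞)) :
    -- `b_Δ^g(a)` is the unique solution in `[1, ρ_Δ)` of the equation `K_Δ^g(a, b) = a`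
    (∀ a ∈ Icc (0 : ℝ) 1, ∀ b : ℝ,
      (b ∈ Ico 1 (ChromaticZeros.rho Δ) ∧ ChromaticZeros.K Δ g a b = a) ↔
        b = ChromaticZeros.bsup Δ g a) ∧
    -- `C(Δ, g)` is the inverse of the positive maximum of `z_Δ^g` on `[0, 1]`
    0 < ChromaticZeros.C Δ g ∧
    IsGreatest (ChromaticZeros.z Δ g '' Icc 0 1) (ChromaticZeros.C Δ g)⁻¹ ∧
    -- the chromatic polynomial has no zero with `|q| ≥ C(Δ, g)`
    ∀ q : ℂ, ChromaticZeros.C Δ g ≤ ‖q‖ →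
      Polynomial.aeval q (ChromaticZeros.chromaticPolynomial G) ≠ 0 := by
  obtain ⟨n, rfl⟩ := Nat.exists_eq_add_of_le' hΔ
  obtain ⟨e, rfl⟩ := Nat.exists_eq_add_of_le' hg
  obtain ⟨a, ha, hamax⟩ := ChromaticZeros.exists_isMaxOn_z n e
  have hgr : IsGreatest (ChromaticZeros.z (n + 3) (e + 3) '' Icc 0 1)
      (ChromaticZeros.z (n + 3) (e + 3) a) :=
    ⟨⟨a, ha, rfl⟩, by rintro _ ⟨a', ha', rfl⟩; exact hamax ha'⟩
  have hC : ChromaticZeros.C (n + 3) (e + 3) = (ChromaticZeros.z (n + 3) (e + 3) a)⁻¹ := by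
    rw [ChromaticZeros.C, hgr.csSup_eq]
  have hpos : 0 < ChromaticZeros.z (n + 3) (e + 3) a :=
    (ChromaticZeros.z_half_pos n e).trans_le (hamax (by constructor <;> norm_num))
  refine ⟨fun a ha b => ChromaticZeros.mem_and_K_eq_iff ha b, ?_, ?_, fun q hq => ?_⟩
  · rw [hC]
    exact inv_pos.2 hpos
  · rwa [hC, inv_inv]
  · rw [hC] at hq
    have hq0 : 0 < ‖q‖ := (inv_pos.2 hpos).trans_le hq
    obtain ⟨t, ht, h⟩ := ChromaticZeros.exists_rootK_eq n e ha
    have hz := ChromaticZeros.z_eq ha.2 ht h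
    -- At `a = 1` the function `z` vanishes, so the maximizer satisfies the strict inequality that
    -- nonvanishing needs.
    have ha1 : a ≠ 1 := by
      rintro rfl
      rw [hz, sub_self, zero_mul] at hpos
      exact hpos.false
    refine ChromaticZeros.aeval_chromaticPolynomial_ne_zero_of_inv_le G
      (fun v => (G.degree_le_maxDegree v).trans hmax.le) hgirth.ge ⟨ha.1, lt_of_le_of_ne ha.2 ha1⟩
      ht h (norm_pos_iff.1 hq0) ?_
    rw [← hz]
    exact inv_le_of_inv_le₀ hpos hq
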